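/- **Setting.** Let $0\le r\le n$ and $I_r=\{1,\dots,r\}$; let $T^*\mathbb R^n$ have coordinates $(q,p)$ and the symplectic form $\sum_j dq_j\wedge dp_j$, and let $\pi(q,p)=q$. For $\sigma\subset I_r$ put $$L^0_\sigma=\{(q,p): q_\sigma=p_{I_r-\sigma}=q_{r+1}=\dots=q_n=0,\ q_{I_r-\sigma}\ge 0\},\qquad \mathbb L=\bigcup_{\sigma\subset I_r}L^0_\sigma .$$ A *reticular Lagrangian map* is a map germ $\pi\circ i:(\mathbb L,0)\to(T^*\mathbb R^n,0)\to(\mathbb R^n,0)$, where $i$ is the restriction to $\mathbb L$ of a symplectic diffeomorphism germ on $(T^*\mathbb R^n,0)$. Let $C_\sigma$ be the set of critical values of $\pi\circ i|_{L^0_\sigma}$ and $Q_{\sigma,\tau}=\pi\circ i(L^0_\sigma\cap L^0_\tau)$ for $\sigma\ne\tau$. Two reticular Lagrangian maps $\pi\circ i_1,\pi\circ i_2$ are *caustic-equivalent* if there is a diffeomorphism germ $g$ on $(\mathbb R^n,0)$ with $$g(C^1_\sigma)=C^2_\sigma,\qquad g(Q^1_{\sigma,\tau})=Q^2_{\sigma,\tau}\qquad\text{for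 all }\sigma,\tau\subset I_r,\ \sigma\neq\tau,$$ as set germs at $0$. (Since the image of a map germ need not be a well-defined set germ, this is understood as follows: for every neighbourhood $W$ of $0$ in $T^*\mathbb R^n$ there is a neighbourhood $W_0$ of $0$ such that for every neighbourhood $W_1\subset W_0$ of $0$ there is a neighbourhood $W_2\subset W$ of $0$ for which all the equalities hold as set germs at $0$ for the representatives of $\pi\circ i_1$ on $\mathbb L\cap W_1$ and of $\pi\circ i_2$ on $\mathbb L\cap W_2$, and the same with the roles of $W_1$ and $W_2$ exchanged.) Let $\mathbb H^r=\{x\in\mathbb R^r:x_1,\dots,x_r\ge 0\}$. Let $\mathcal E(r;k+n)$ be the ring of germs at $0$ of smooth functions of $(x,y,q)\in\mathbb H^r\times\mathbb R^k\times\mathbb R^n$, let $\mathfrak M(r;k+n)$ be its maximal ideal, and let $\mathcal E(n)$ be the ring of germs at $0$ of smooth functions on $\mathbb R^n$. A germ $F\in\mathfrak M(r;k+n)^2$ is a *generating family* of $\pi\circ i$ if the differentials at $0$ of $x_1,\dots,x_r,\frac{\partial F}{\partial x_1},\dots,\frac{\partial F}{\partial x_r},\frac{\partial F}{\partial y_1},\dots,\frac{\partial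 F}{\partial y_k}$ are linearly independent and, for every $\sigma\subset I_r$, as set germs at $0$, $$i(L^0_\sigma)=\Big\{\Big(q,\frac{\partial F}{\partial q}(x,y,q)\Big): x_\sigma=\frac{\partial F}{\partial x_{I_r-\sigma}}=\frac{\partial F}{\partial y}=0,\ x_{I_r-\sigma}\ge 0\Big\}.$$ Two germs $F,G\in\mathcal E(r;k+n)$ are *reticular $\mathcal P$-$\mathcal C$-equivalent* if $G=a\cdot F\circ\Phi+b$ for some $b\in\mathcal E(n)$, some $a\in\mathcal E(n)$ with $a(0)\ne0$, and some diffeomorphism germ $\Phi$ on $(\mathbb H^r\times\mathbb R^{k+n},0)$ of the form $\Phi(x,y,q)=(x_1\phi_1(x,y,q),\dots,x_r\phi_r(x,y,q),\phi'(x,y,q),\phi''(q))$. Germs $F\in\mathcal E(r;k_1+n)$ and $G\in\mathcal E(r;k_2+n)$ are *stably reticular $\mathcal P$-$\mathcal C$-equivalent* if they become reticular $\mathcal P$-$\mathcal C$-equivalent after adding to each a non-degenerate quadratic form in (finitely many, possibly zero) new variables of type $y$. **Proposition.** Let $\pi\circ i_1$ and $\pi\circ i_2$ be reticular Lagrangian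 maps (with the same $r$ and $n$) with generating families $F_1\in\mathfrak M(r;k_1+n)^2$ and $F_2\in\mathfrak M(r;k_2+n)^2$. If $F_1$ and $F_2$ are stably reticular $\mathcal P$-$\mathcal C$-equivalent, then $\pi\circ i_1$ and $\pi\circ i_2$ are caustic-equivalent. -/

import Mathlib

open Set Filter Topology
open scoped ContDiff

/-- A (representative of a) diffeomorphism germ `(E, 0) → (F, 0)`. -/
structure DiffeoGerm (E F : Type) [NormedAddCommGroup E] [NormedSpace ℝ E]
    [NormedAddCommGroup F] [NormedSpace ℝ F] where
  toHomeo : OpenPartialHomeomorph E F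
  zero_mem : (0 : E) ∈ toHomeo.source
  map_zero : toHomeo 0 = 0
  smooth : ContDiffOn ℝ ∞ toHomeo toHomeo.source
  smooth_symm : ContDiffOn ℝ ∞ toHomeo.symm toHomeo.target

/-- `f` is (a representative of) a smooth germ at `0`: it is `C^∞` on a neighbourhood of `0`. -/
def SmoothGerm {E F : Type} [NormedAddCommGroup E] [NormedSpace ℝ E]
    [NormedAddCommGroup F] [NormedSpace ℝ F] (f : E → F) : Prop :=
  ∃ U ∈ 𝓝 (0 : E), ContDiffOn ℝ ∞ f U

/-! ### Reticular Lagrangian maps and their caustics -/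

/-- The cotangent bundle `T^*ℝⁿ`, with points `(q, p)`. -/
abbrev Cotangent (n : ℕ) : Type := (Fin n → ℝ) × (Fin n → ℝ)

/-- The canonical symplectic form `∑ dq_j ∧ dp_j` on `T^*ℝⁿ`. -/
def canonicalForm {n : ℕ} (u v : Cotangent n) : ℝ :=
  ∑ j, (u.1 j * v.2 j - u.2 j * v.1 j)

/-- A (representative of a) symplectic diffeomorphism germ on `(T^*ℝⁿ, 0)`. -/
structure SymplecticGerm (n : ℕ) extends DiffeoGerm (Cotangent n) (Cotangent n) where
  symplectic : ∀ z ∈ toHomeo.source, ∀ u v : Cotangent n,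
    canonicalForm (fderiv ℝ toHomeo z u) (fderiv ℝ toHomeo z v) = canonicalForm u v

/-- The linear space `{q_σ = 0, p_{I_r - σ} = 0, q_{r+1} = ⋯ = q_n = 0}`, which is the tangent
space of `L_σ⁰` at each of its points. -/
def tangentL {r n : ℕ} (hrn : r ≤ n) (σ : Finset (Fin r)) : Set (Cotangent n) :=
  {z | (∀ i ∈ σ, z.1 (Fin.castLE hrn i) = 0) ∧ (∀ i ∉ σ, z.2 (Fin.castLE hrn i) = 0) ∧
    ∀ j : Fin n, r ≤ (j : ℕ) → z.1 j = 0}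

/-- `L_σ⁰ = {q_σ = p_{I_r - σ} = q_{r+1} = ⋯ = q_n = 0, q_{I_r - σ} ≥ 0}`. -/
def stdL {r n : ℕ} (hrn : r ≤ n) (σ : Finset (Fin r)) : Set (Cotangent n) :=
  {z | z ∈ tangentL hrn σ ∧ ∀ i ∉ σ, 0 ≤ z.1 (Fin.castLE hrn i)}

/- A reticular Lagrangian map is `π ∘ i` with `i` the restriction of a symplectic diffeomorphism
germ `S` to `𝕃 = ⋃_σ L_σ⁰`. It is presented by an extension `S` of `i`; everything below
depends on the restriction of `S` to `𝕃` only. -/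

/-- The critical points in `W` of the Lagrangian map `π ∘ i|_{L_σ⁰}`: the differential, on the
`n`-dimensional tangent space of `L_σ⁰`, has a nonzero kernel (equivalently, rank `< n`). -/
def critPoints {r n : ℕ} (hrn : r ≤ n) (S : SymplecticGerm n) (σ : Finset (Fin r))
    (W : Set (Cotangent n)) : Set (Cotangent n) :=
  {z | z ∈ stdL hrn σ ∩ W ∩ S.toHomeo.source ∧
    ∃ v ∈ tangentL hrn σ, v ≠ 0 ∧ (fderiv ℝ S.toHomeo z v).1 = 0}

/-- The caustic `C_σ` (set of critical values of `π ∘ i|_{L_σ⁰}`), for the representative of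
`π ∘ i` on `𝕃 ∩ W`. -/
def caustic {r n : ℕ} (hrn : r ≤ n) (S : SymplecticGerm n) (σ : Finset (Fin r))
    (W : Set (Cotangent n)) : Set (Fin n → ℝ) :=
  (fun z => (S.toHomeo z).1) '' critPoints hrn S σ W

/-- The quasi-caustic `Q_{σ,τ} = π ∘ i (L_σ⁰ ∩ L_τ⁰)`, for the representative of `π ∘ i`
on `𝕃 ∩ W`. -/
def quasiCaustic {r n : ℕ} (hrn : r ≤ n) (S : SymplecticGerm n) (σ τ : Finset (Fin r))
    (W : Set (Cotangent n)) : Set (Fin n → ℝ) :=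
  (fun z => (S.toHomeo z).1) '' (stdL hrn σ ∩ stdL hrn τ ∩ W ∩ S.toHomeo.source)

/-- For the representatives on `W₁` and `W₂`, one has, as set germs at `0`,
`g(C¹_σ) = C²_σ` and `g(Q¹_{σ,τ}) = Q²_{σ,τ}` for all `σ ≠ τ`. -/
def MapsCaustics {r n : ℕ} (hrn : r ≤ n) (S₁ S₂ : SymplecticGerm n)
    (g : DiffeoGerm (Fin n → ℝ) (Fin n → ℝ)) (W₁ W₂ : Set (Cotangent n)) : Prop :=
  (∀ σ : Finset (Fin r),
    (g.toHomeo '' caustic hrn S₁ σ W₁ : Set (Fin n → ℝ)) =ᶠ[𝓝 0] caustic hrn S₂ σ W₂) ∧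
  ∀ σ τ : Finset (Fin r), σ ≠ τ →
    (g.toHomeo '' quasiCaustic hrn S₁ σ τ W₁ : Set (Fin n → ℝ)) =ᶠ[𝓝 0]
      quasiCaustic hrn S₂ σ τ W₂

/-- Caustic-equivalence: there is a diffeomorphism germ `g` on `(ℝⁿ, 0)` that maps every `C¹_σ`
to `C²_σ` and every `Q¹_{σ,τ}` to `Q²_{σ,τ}`.
The image of a map germ need not be a well-defined set germ (consider `(u, v) ↦ (u, u v)`), so the
equalities are required between representatives: each sufficiently small representative on either
side corresponds to an arbitrarily small one on the other side. Where the germs of the images do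
not depend on the (small) representatives, this is equality of set germs. -/
def CausticEquivalent {r n : ℕ} (hrn : r ≤ n) (S₁ S₂ : SymplecticGerm n) : Prop :=
  ∃ g : DiffeoGerm (Fin n → ℝ) (Fin n → ℝ),
    ∀ W ∈ 𝓝 (0 : Cotangent n), ∃ W₀ ∈ 𝓝 (0 : Cotangent n),
      (∀ W₁ ∈ 𝓝 (0 : Cotangent n), W₁ ⊆ W₀ →
        ∃ W₂ ∈ 𝓝 (0 : Cotangent n), W₂ ⊆ W ∧ MapsCaustics hrn S₁ S₂ g W₁ W₂) ∧
      (∀ W₂ ∈ 𝓝 (0 : Cotangent n), W₂ ⊆ W₀ →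
        ∃ W₁ ∈ 𝓝 (0 : Cotangent n), W₁ ⊆ W ∧ MapsCaustics hrn S₁ S₂ g W₁ W₂)

/-! ### Generating families -/

/-- The space `ℝ^r × ℝ^k × ℝ^n` of `(x, y, q)`. -/
abbrev XYQ (r k n : ℕ) : Type := (Fin r → ℝ) × (Fin k → ℝ) × (Fin n → ℝ)

/-- `ℍ^r × ℝ^{k+n}`, where `ℍ^r = {x ∈ ℝ^r | x_1 ≥ 0, …, x_r ≥ 0}`. -/
def corner (r k n : ℕ) : Set (XYQ r k n) := {z | ∀ i, 0 ≤ z.1 i}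

/- A function germ on `(ℍ^r × ℝ^{k+n}, 0)` is given by a smooth extension to a neighbourhood of `0`
in `ℝ^{r+k+n}`. Derivatives at points of the corner do not depend on the extension. -/

/-- `∂F/∂x_i`. -/
noncomputable def dX {r k n : ℕ} (F : XYQ r k n → ℝ) (i : Fin r) (z : XYQ r k n) : ℝ :=
  fderiv ℝ F z (Pi.single i 1, 0, 0)

/-- `∂F/∂y_j`. -/
noncomputable def dY {r k n : ℕ} (F : XYQ r k n → ℝ) (j : Fin k) (z : XYQ r k n) : ℝ :=
  fderiv ℝ F z (0, Pi.single j 1, 0)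

/-- `∂F/∂q = (∂F/∂q_1, …, ∂F/∂q_n)`. -/
noncomputable def dQ {r k n : ℕ} (F : XYQ r k n → ℝ) (z : XYQ r k n) : Fin n → ℝ :=
  fun l => fderiv ℝ F z (0, 0, Pi.single l 1)

/-- `F` is `S`-non-degenerate: the functions `x_i`, `∂F/∂x_i`, `∂F/∂y_j` are independent at `0`,
that is, their differentials at `0` are linearly independent. -/
def SNondegenerate {r k n : ℕ} (F : XYQ r k n → ℝ) : Prop :=
  LinearIndependent ℝ (Sum.elim (fun i : Fin r => fderiv ℝ (fun z : XYQ r k n => z.1 i) 0)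
    (Sum.elim (fun i : Fin r => fderiv ℝ (dX F i) 0) (fun j : Fin k => fderiv ℝ (dY F j) 0)))

/-- The points of the corner with `x_σ = 0`, `∂F/∂x_{I_r - σ} = 0` and `∂F/∂y = 0`. -/
def fiberCritical {r k n : ℕ} (F : XYQ r k n → ℝ) (σ : Finset (Fin r)) : Set (XYQ r k n) :=
  {z | z ∈ corner r k n ∧ (∀ i ∈ σ, z.1 i = 0) ∧ (∀ i ∉ σ, dX F i z = 0) ∧ ∀ j, dY F j z = 0}

/-- `F` is a generating family of the reticular Lagrangian map `π ∘ S|_𝕃`: it is an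
`S`-non-degenerate element of `𝔐(r; k+n)²` and, as set germs at `0`,
`i(L_σ⁰) = {(q, ∂F/∂q) | x_σ = ∂F/∂x_{I_r - σ} = ∂F/∂y = 0, x_{I_r - σ} ≥ 0}` for all `σ`. -/
def IsGeneratingFamily {r k n : ℕ} (hrn : r ≤ n) (S : SymplecticGerm n)
    (F : XYQ r k n → ℝ) : Prop :=
  SmoothGerm F ∧ F 0 = 0 ∧ fderiv ℝ F 0 = 0 ∧ SNondegenerate F ∧
  ∃ U ∈ 𝓝 (0 : XYQ r k n), ∀ W ∈ 𝓝 (0 : XYQ r k n), W ⊆ U → ∀ σ : Finset (Fin r),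
    (S.toHomeo '' (stdL hrn σ ∩ S.toHomeo.source) : Set (Cotangent n)) =ᶠ[𝓝 0]
      ((fun z : XYQ r k n => ((z.2.2, dQ F z) : Cotangent n)) '' (fiberCritical F σ ∩ W) :
        Set (Cotangent n))

/-! ### Stable reticular `𝒫`-`𝒞`-equivalence -/

/-- `Φ ∈ ℬ_n(r; k+n)`: `Φ` is a diffeomorphism germ that preserves the corner and has the form
`Φ(x, y, q) = (x_1 φ_1(x, y, q), …, x_r φ_r(x, y, q), φ'(x, y, q), φ''(q))`. (The numbers `k`, `k'`
of variables `y` in source and target agree as soon as such a `Φ` exists.) -/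
def IsReticularDiffeo {r k k' n : ℕ} (Φ : DiffeoGerm (XYQ r k n) (XYQ r k' n)) : Prop :=
  (∀ z ∈ Φ.toHomeo.source, z ∈ corner r k n ↔ Φ.toHomeo z ∈ corner r k' n) ∧
  (∃ φ : XYQ r k n → Fin r → ℝ, ContDiffOn ℝ ∞ φ Φ.toHomeo.source ∧
    ∀ z ∈ Φ.toHomeo.source, ∀ i, (Φ.toHomeo z).1 i = z.1 i * φ z i) ∧
  ∃ ψ : (Fin n → ℝ) → (Fin n → ℝ), ∀ z ∈ Φ.toHomeo.source, (Φ.toHomeo z).2.2 = ψ z.2.2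

/-- Reticular `𝒫`-`𝒞`-equivalence: `G = a · F ∘ Φ + b` on `(ℍ^r × ℝ^{k+n}, 0)` with
`Φ ∈ ℬ_n(r; k+n)`, a unit `a ∈ ℰ(n)` and `b ∈ ℰ(n)`. -/
def PCEquivalent {r k k' n : ℕ} (F : XYQ r k n → ℝ) (G : XYQ r k' n → ℝ) : Prop :=
  ∃ (Φ : DiffeoGerm (XYQ r k' n) (XYQ r k n)) (a b : (Fin n → ℝ) → ℝ),
    IsReticularDiffeo Φ ∧ SmoothGerm a ∧ a 0 ≠ 0 ∧ SmoothGerm b ∧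
    ∀ᶠ z in 𝓝[corner r k' n] 0, G z = a z.2.2 * F (Φ.toHomeo z) + b z.2.2

/-- `F(x, y, q) + Q(y')` with `l` new variables `y'`. -/
def addQuadratic {r k l n : ℕ} (F : XYQ r k n → ℝ) (Q : QuadraticForm ℝ (Fin l → ℝ)) :
    XYQ r (k + l) n → ℝ :=
  fun z => F (z.1, fun j => z.2.1 (Fin.castAdd l j), z.2.2) + Q (fun j => z.2.1 (Fin.natAdd k j))

/-- Stable reticular `𝒫`-`𝒞`-equivalence: `F` and `G` become reticular `𝒫`-`𝒞`-equivalent after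
adding non-degenerate quadratic forms in new variables of type `y`. -/
def StablyPCEquivalent {r k k' n : ℕ} (F : XYQ r k n → ℝ) (G : XYQ r k' n → ℝ) : Prop :=
  ∃ (l l' : ℕ) (Q : QuadraticForm ℝ (Fin l → ℝ)) (Q' : QuadraticForm ℝ (Fin l' → ℝ)),
    (QuadraticMap.polarBilin Q).Nondegenerate ∧ (QuadraticMap.polarBilin Q').Nondegenerate ∧
    PCEquivalent (addQuadratic F Q) (addQuadratic G Q')

/-! Over a point `q`, the points of `i(L_σ⁰)` are the critical points of `F(·, ·, q)` in the
variables `x_{I_r - σ}` and `y`, taken on `x_σ = 0`. Such a point is critical for `π ∘ i` exactly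
when the Hessian of `F` in these variables is degenerate there (`mem_singularPoints_iff`). Caustics
and quasi-caustics can therefore be read off the fiberwise critical sets of `F` and their degenerate
points.

These data survive each move of stable equivalence. A non-degenerate quadratic form forces the new
variables to vanish and adds a non-degenerate block to the Hessian (`isGermIso_addQuadratic`). For
`G = a · H ∘ Φ + b`, the functions `a` and `b` are constant along the fibers and `dΦ` maps fiber
directions onto fiber directions, so first derivatives, and Hessians at critical points, correspond
up to the factor `a ≠ 0` (`isGermIso_of_eq_mul_comp_add`).

Non-degeneracy of the family makes its critical points a smooth function of `(q, ∂F/∂q)`. This turns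
equality of images into a pointwise correspondence (`IsGeneratingFamily.exists_isGermIso`). Every
correspondence is one pair of maps serving all `σ`, hence it respects the intersections `L_σ⁰ ∩
L_τ⁰`. The composite covers the base component `ψ` of `Φ`, and `g` is a local inverse of `ψ`. -/

/-! ### Isomorphisms of families of set germs -/

/-- The maps `A` and `B` are mutually inverse germs of homeomorphisms between the members of the
families `P` and `P'` of set germs at `0`; they match the conditions `D` and `D'` and lift the map
`h` along `p` and `p'`. -/
structure IsGermIso {ι X Y Q : Type} [TopologicalSpace X] [Zero X] [TopologicalSpace Y] [Zero Y]
    (A : X → Y) (B : Y → X) (P D : ι → Set X) (p : X → Q) (P' D' : ι → Set Y) (p' : Y → Q)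
    (h : Q → Q) : Prop where
  tendsto : Tendsto A (𝓝 0) (𝓝 0)
  tendsto_inv : Tendsto B (𝓝 0) (𝓝 0)
  forward : ∀ᶠ x in 𝓝 (0 : X), ∀ i, x ∈ P i →
    A x ∈ P' i ∧ B (A x) = x ∧ p' (A x) = h (p x) ∧ (x ∈ D i ↔ A x ∈ D' i)
  backward : ∀ᶠ y in 𝓝 (0 : Y), ∀ i, y ∈ P' i → B y ∈ P i ∧ A (B y) = y

namespace IsGermIso

variable {ι X Y Z Q : Type} [TopologicalSpace X] [Zero X] [TopologicalSpace Y] [Zero Y]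
  [TopologicalSpace Z] [Zero Z]

/-- Restricting to `id` on the base avoids having to invert `h`. -/
theorem symm {A : X → Y} {B : Y → X} {P D : ι → Set X} {p : X → Q} {P' D' : ι → Set Y}
    {p' : Y → Q} (H : IsGermIso A B P D p P' D' p' id) : IsGermIso B A P' D' p' P D p id where
  tendsto := H.tendsto_inv
  tendsto_inv := H.tendsto
  forward := by
    filter_upwards [H.backward, H.tendsto_inv.eventually H.forward] with y hy hB i hi
    obtain ⟨h1, h2⟩ := hy i hi
    obtain ⟨-, -, h3, h4⟩ := hB i h1
    rw [h2] at h3 h4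
    exact ⟨h1, h2, h3.symm, h4.symm⟩
  backward := by
    filter_upwards [H.forward] with x hx i hi
    exact ⟨(hx i hi).1, (hx i hi).2.1⟩

theorem trans {A : X → Y} {B : Y → X} {P D : ι → Set X} {p : X → Q} {P' D' : ι → Set Y}
    {p' : Y → Q} {h : Q → Q} {A' : Y → Z} {B' : Z → Y} {P'' D'' : ι → Set Z} {p'' : Z → Q}
    {h' : Q → Q} (H : IsGermIso A B P D p P' D' p' h)
    (H' : IsGermIso A' B' P' D' p' P'' D'' p'' h') :
    IsGermIso (A' ∘ A) (B ∘ B') P D p P'' D'' p'' (h' ∘ h) where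
  tendsto := H'.tendsto.comp H.tendsto
  tendsto_inv := H.tendsto_inv.comp H'.tendsto_inv
  forward := by
    filter_upwards [H.forward, H.tendsto.eventually H'.forward] with x hx hA i hi
    obtain ⟨h1, h2, h3, h4⟩ := hx i hi
    obtain ⟨k1, k2, k3, k4⟩ := hA i h1
    exact ⟨k1, by simp [k2, h2], by simp [k3, h3], h4.trans k4⟩
  backward := by
    filter_upwards [H'.backward, H'.tendsto_inv.eventually H.backward] with z hz hB i hi
    obtain ⟨h1, h2⟩ := hz i hi
    obtain ⟨k1, k2⟩ := hB i h1
    exact ⟨k1, by simp [k2, h2]⟩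

end IsGermIso

/-- The points where the differential of `π ∘ S` has a nonzero kernel on the tangent space of
`L_σ⁰`. -/
def singularPoints {r n : ℕ} (hrn : r ≤ n) (S : SymplecticGerm n) (σ : Finset (Fin r)) :
    Set (Cotangent n) :=
  {z | ∃ v ∈ tangentL hrn σ, v ≠ 0 ∧ (fderiv ℝ S.toHomeo z v).1 = 0}

theorem mem_critPoints {r n : ℕ} {hrn : r ≤ n} {S : SymplecticGerm n} {σ : Finset (Fin r)}
    {W : Set (Cotangent n)} {z : Cotangent n} :
    z ∈ critPoints hrn S σ W ↔
      ((z ∈ stdL hrn σ ∧ z ∈ W) ∧ z ∈ S.toHomeo.source) ∧ z ∈ singularPoints hrn S σ :=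
  Iff.rfl

/-! ### Diffeomorphism germs -/

namespace DiffeoGerm

variable {E F : Type} [NormedAddCommGroup E] [NormedSpace ℝ E] [NormedAddCommGroup F]
  [NormedSpace ℝ F]

theorem source_mem (Φ : DiffeoGerm E F) : Φ.toHomeo.source ∈ 𝓝 (0 : E) :=
  Φ.toHomeo.open_source.mem_nhds Φ.zero_mem

theorem zero_mem_target (Φ : DiffeoGerm E F) : (0 : F) ∈ Φ.toHomeo.target := by
  simpa [Φ.map_zero] using Φ.toHomeo.map_source Φ.zero_mem

theorem target_mem (Φ : DiffeoGerm E F) : Φ.toHomeo.target ∈ 𝓝 (0 : F) :=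
  Φ.toHomeo.open_target.mem_nhds Φ.zero_mem_target

theorem symm_zero (Φ : DiffeoGerm E F) : Φ.toHomeo.symm 0 = 0 := by
  simpa [Φ.map_zero] using Φ.toHomeo.left_inv Φ.zero_mem

theorem tendsto (Φ : DiffeoGerm E F) : Tendsto Φ.toHomeo (𝓝 0) (𝓝 0) := by
  simpa [ContinuousAt, Φ.map_zero] using Φ.toHomeo.continuousAt Φ.zero_mem

theorem tendsto_symm (Φ : DiffeoGerm E F) : Tendsto Φ.toHomeo.symm (𝓝 0) (𝓝 0) := by
  simpa [ContinuousAt, Φ.symm_zero] using Φ.toHomeo.continuousAt_symm Φ.zero_mem_target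

theorem contDiffAt (Φ : DiffeoGerm E F) {z : E} (hz : z ∈ Φ.toHomeo.source) :
    ContDiffAt ℝ ∞ Φ.toHomeo z :=
  Φ.smooth.contDiffAt (Φ.toHomeo.open_source.mem_nhds hz)

theorem differentiableAt (Φ : DiffeoGerm E F) {z : E} (hz : z ∈ Φ.toHomeo.source) :
    DifferentiableAt ℝ Φ.toHomeo z :=
  (Φ.contDiffAt hz).differentiableAt (by simp)

theorem differentiableAt_symm (Φ : DiffeoGerm E F) {z : F} (hz : z ∈ Φ.toHomeo.target) :
    DifferentiableAt ℝ Φ.toHomeo.symm z :=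
  (Φ.smooth_symm.contDiffAt (Φ.toHomeo.open_target.mem_nhds hz)).differentiableAt (by simp)

theorem fderiv_symm_comp_fderiv (Φ : DiffeoGerm E F) {z : E} (hz : z ∈ Φ.toHomeo.source) (v : E) :
    fderiv ℝ Φ.toHomeo.symm (Φ.toHomeo z) (fderiv ℝ Φ.toHomeo z v) = v := by
  have h1 := ((Φ.differentiableAt_symm (Φ.toHomeo.map_source hz)).hasFDerivAt).comp z
    (Φ.differentiableAt hz).hasFDerivAt
  have h2 : HasFDerivAt (Φ.toHomeo.symm ∘ Φ.toHomeo) (ContinuousLinearMap.id ℝ E) z := by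
    refine (hasFDerivAt_id z).congr_of_eventuallyEq ?_
    filter_upwards [Φ.toHomeo.open_source.mem_nhds hz] with w hw
    exact Φ.toHomeo.left_inv hw
  exact DFunLike.congr_fun (h1.unique h2) v

theorem fderiv_injective (Φ : DiffeoGerm E F) {z : E} (hz : z ∈ Φ.toHomeo.source) :
    Function.Injective (fderiv ℝ Φ.toHomeo z) :=
  Function.LeftInverse.injective (Φ.fderiv_symm_comp_fderiv hz)

theorem fderiv_comp_fderiv_symm (Φ : DiffeoGerm E F) {z : E} (hz : z ∈ Φ.toHomeo.source) (v : F) :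
    fderiv ℝ Φ.toHomeo z (fderiv ℝ Φ.toHomeo.symm (Φ.toHomeo z) v) = v := by
  have h0 : DifferentiableAt ℝ Φ.toHomeo (Φ.toHomeo.symm (Φ.toHomeo z)) := by
    rw [Φ.toHomeo.left_inv hz]; exact Φ.differentiableAt hz
  have h1 := h0.hasFDerivAt.comp (Φ.toHomeo z)
    (Φ.differentiableAt_symm (Φ.toHomeo.map_source hz)).hasFDerivAt
  have h2 : HasFDerivAt (Φ.toHomeo ∘ Φ.toHomeo.symm) (ContinuousLinearMap.id ℝ F)
      (Φ.toHomeo z) := by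
    refine (hasFDerivAt_id _).congr_of_eventuallyEq ?_
    filter_upwards [Φ.toHomeo.open_target.mem_nhds (Φ.toHomeo.map_source hz)] with w hw
    exact Φ.toHomeo.right_inv hw
  have h3 := DFunLike.congr_fun (h1.unique h2) v
  rw [Φ.toHomeo.left_inv hz] at h3
  exact h3

end DiffeoGerm

/-! ### From germ isomorphisms to caustic-equivalence -/

/-- A homeomorphism germ between the `L_σ⁰` that matches singular points and covers a
diffeomorphism germ of the base gives a caustic-equivalence. -/
theorem CausticEquivalent.of_isGermIso {r n : ℕ} {hrn : r ≤ n} {S₁ S₂ : SymplecticGerm n}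
    {A B : Cotangent n → Cotangent n} {h : (Fin n → ℝ) → (Fin n → ℝ)}
    (H : IsGermIso A B (stdL hrn) (singularPoints hrn S₂) (fun z => (S₂.toHomeo z).1)
      (stdL hrn) (singularPoints hrn S₁) (fun z => (S₁.toHomeo z).1) h)
    (g : DiffeoGerm (Fin n → ℝ) (Fin n → ℝ)) (hg : ∀ᶠ q in 𝓝 0, g.toHomeo (h q) = q) :
    CausticEquivalent hrn S₁ S₂ := by
  have hp : Tendsto (fun z => (S₂.toHomeo z).1) (𝓝 0) (𝓝 0) :=
    continuous_fst.continuousAt.tendsto.comp S₂.tendsto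
  let V₂ : Set (Cotangent n) := {z | (∀ σ, z ∈ stdL hrn σ → A z ∈ stdL hrn σ ∧ B (A z) = z ∧
    g.toHomeo ((S₁.toHomeo (A z)).1) = (S₂.toHomeo z).1 ∧
      (z ∈ singularPoints hrn S₂ σ ↔ A z ∈ singularPoints hrn S₁ σ)) ∧
    z ∈ S₂.toHomeo.source ∧ A z ∈ S₁.toHomeo.source}
  have hV₂ : V₂ ∈ 𝓝 0 := by
    filter_upwards [H.forward, hp.eventually hg, S₂.source_mem, H.tendsto S₁.source_mem]
      with z h1 h2 h3 h4
    refine ⟨fun σ hσ => ?_, h3, h4⟩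
    obtain ⟨k1, k2, k3, k4⟩ := h1 σ hσ
    exact ⟨k1, k2, by rw [k3]; exact h2, k4⟩
  let V₁ : Set (Cotangent n) := {z | (∀ σ, z ∈ stdL hrn σ → B z ∈ stdL hrn σ ∧ A (B z) = z) ∧
    B z ∈ V₂}
  have hV₁ : V₁ ∈ 𝓝 0 := by
    filter_upwards [H.backward, H.tendsto_inv hV₂] with z h1 h2 using ⟨h1, h2⟩
  -- Once `A` and `B` exchange the parts of the `L_σ⁰` in the two neighbourhoods, the images agree
  -- as sets, not merely as germs.
  have key : ∀ W₁ W₂ : Set (Cotangent n), W₁ ⊆ V₁ → W₂ ⊆ V₂ →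
      (∀ σ, ∀ z ∈ W₂, z ∈ stdL hrn σ → A z ∈ W₁) → (∀ σ, ∀ z ∈ W₁, z ∈ stdL hrn σ → B z ∈ W₂) →
      MapsCaustics hrn S₁ S₂ g W₁ W₂ := by
    intro W₁ W₂ hW₁ hW₂ hA hB
    refine ⟨fun σ => ?_, fun σ τ _ => ?_⟩
    · refine Eq.eventuallyEq (Set.Subset.antisymm ?_ ?_)
      · rintro _ ⟨_, ⟨z, hz, rfl⟩, rfl⟩
        obtain ⟨⟨⟨hz1, hz2⟩, hz3⟩, hz4⟩ := mem_critPoints.1 hz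
        obtain ⟨k1, k2⟩ := (hW₁ hz2).1 σ hz1
        obtain ⟨l1, l2, l3⟩ := (hW₁ hz2).2
        obtain ⟨-, -, m3, m4⟩ := l1 σ k1
        rw [k2] at m3 m4
        exact ⟨B z, mem_critPoints.2 ⟨⟨⟨k1, hB σ z hz2 hz1⟩, l2⟩, m4.2 hz4⟩, m3.symm⟩
      · rintro _ ⟨z, hz, rfl⟩
        obtain ⟨⟨⟨hz1, hz2⟩, hz3⟩, hz4⟩ := mem_critPoints.1 hz
        obtain ⟨l1, l2, l3⟩ := hW₂ hz2
        obtain ⟨m1, m2, m3, m4⟩ := l1 σ hz1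
        exact ⟨_, ⟨A z, mem_critPoints.2 ⟨⟨⟨m1, hA σ z hz2 hz1⟩, l3⟩, m4.1 hz4⟩, rfl⟩, m3⟩
    · refine Eq.eventuallyEq (Set.Subset.antisymm ?_ ?_)
      · rintro _ ⟨_, ⟨z, ⟨⟨⟨hz0, hz1⟩, hz2⟩, hz3⟩, rfl⟩, rfl⟩
        obtain ⟨k1, k2⟩ := (hW₁ hz2).1 σ hz0
        obtain ⟨l1, l2, l3⟩ := (hW₁ hz2).2
        obtain ⟨-, -, m3, -⟩ := l1 σ k1
        rw [k2] at m3
        exact ⟨B z, ⟨⟨⟨k1, ((hW₁ hz2).1 τ hz1).1⟩, hB σ z hz2 hz0⟩, l2⟩, m3.symm⟩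
      · rintro _ ⟨z, ⟨⟨⟨hz0, hz1⟩, hz2⟩, hz3⟩, rfl⟩
        obtain ⟨l1, l2, l3⟩ := hW₂ hz2
        obtain ⟨m1, m2, m3, -⟩ := l1 σ hz0
        exact ⟨_, ⟨A z, ⟨⟨⟨m1, (l1 τ hz1).1⟩, hA σ z hz2 hz0⟩, l3⟩, rfl⟩, m3⟩
  -- The first factor serves a given `W₁`: it puts `B z` into `V₂ ∩ W`, while `A (B z) = z` lies in
  -- `W₁`. The second serves a given `W₂` in the same way, with `A z` in `V₁ ∩ W`.
  refine ⟨g, fun W hW => ⟨(V₁ ∩ B ⁻¹' W) ∩ (V₂ ∩ A ⁻¹' (W ∩ V₁)), ?_, ?_, ?_⟩⟩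
  · exact inter_mem (inter_mem hV₁ (H.tendsto_inv hW))
      (inter_mem hV₂ (H.tendsto (inter_mem hW hV₁)))
  · intro W₁ hW₁ hsub
    refine ⟨V₂ ∩ W ∩ A ⁻¹' W₁, inter_mem (inter_mem hV₂ hW) (H.tendsto hW₁),
      fun z hz => hz.1.2, key _ _ (fun z hz => (hsub hz).1.1) (fun z hz => hz.1.1)
        (fun σ z hz _ => hz.2) fun σ z hz hσ => ⟨⟨(hsub hz).1.1.2, (hsub hz).1.2⟩, ?_⟩⟩
    rw [mem_preimage, ((hsub hz).1.1.1 σ hσ).2]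
    exact hz
  · intro W₂ hW₂ hsub
    refine ⟨V₁ ∩ W ∩ B ⁻¹' W₂, inter_mem (inter_mem hV₁ hW) (H.tendsto_inv hW₂),
      fun z hz => hz.1.2, key _ _ (fun z hz => hz.1.1) (fun z hz => (hsub hz).2.1)
        (fun σ z hz hσ => ⟨⟨(hsub hz).2.2.2, (hsub hz).2.2.1⟩, ?_⟩) fun σ z hz _ => hz.2⟩
    rw [mem_preimage, ((hsub hz).2.1.1 σ hσ).2.1]
    exact hz

theorem SmoothGerm.eventually_contDiffAt {E F : Type} [NormedAddCommGroup E] [NormedSpace ℝ E]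
    [NormedAddCommGroup F] [NormedSpace ℝ F] {f : E → F} (h : SmoothGerm f) :
    ∀ᶠ z in 𝓝 (0 : E), ContDiffAt ℝ ∞ f z := by
  obtain ⟨U, hU, hf⟩ := h
  filter_upwards [eventually_mem_nhds_iff.2 hU] with z hz using hf.contDiffAt hz

theorem ContDiffAt.differentiableAt_fderiv {E F : Type} [NormedAddCommGroup E] [NormedSpace ℝ E]
    [NormedAddCommGroup F] [NormedSpace ℝ F] {f : E → F} {z : E} (h : ContDiffAt ℝ ∞ f z) :
    DifferentiableAt ℝ (fderiv ℝ f) z :=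
  (h.fderiv_right (m := ∞) (by simp)).differentiableAt (by simp)

/-! ### Fiber directions and fiberwise critical points -/

section FiberDirections

variable {r k n : ℕ}

/-- The directions along `x_{I_r - σ}` and `y`: the vectors with vanishing `q`- and
`x_σ`-components. -/
def fiberDir (r k n : ℕ) (σ : Finset (Fin r)) : Submodule ℝ (XYQ r k n) where
  carrier := {w | w.2.2 = 0 ∧ ∀ i ∈ σ, w.1 i = 0}
  add_mem' := by
    rintro a b ⟨ha, ha'⟩ ⟨hb, hb'⟩
    exact ⟨by simp [ha, hb], fun i hi => by simp [ha' i hi, hb' i hi]⟩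
  zero_mem' := ⟨rfl, fun _ _ => rfl⟩
  smul_mem' := by
    rintro c a ⟨ha, ha'⟩
    exact ⟨by simp [ha], fun i hi => by simp [ha' i hi]⟩

theorem mem_fiberDir {σ : Finset (Fin r)} {w : XYQ r k n} :
    w ∈ fiberDir r k n σ ↔ w.2.2 = 0 ∧ ∀ i ∈ σ, w.1 i = 0 :=
  Iff.rfl

theorem XYQ.eq_sum (w : XYQ r k n) :
    w = ∑ i, w.1 i • ((Pi.single i 1, 0, 0) : XYQ r k n) +
      ∑ j, w.2.1 j • ((0, Pi.single j 1, 0) : XYQ r k n) +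
      ∑ l, w.2.2 l • ((0, 0, Pi.single l 1) : XYQ r k n) := by
  have h : ∀ (m : ℕ) (f : Fin m → ℝ), ∑ i, f i • (Pi.single i 1 : Fin m → ℝ) = f :=
    fun m f => (pi_eq_sum_univ' f).symm
  refine Prod.ext ?_ (Prod.ext ?_ ?_) <;>
    simp [Prod.fst_sum, Prod.snd_sum, h]

theorem forall_mem_fiberDir_iff {σ : Finset (Fin r)} (L : XYQ r k n →L[ℝ] ℝ) :
    (∀ w ∈ fiberDir r k n σ, L w = 0) ↔
      (∀ i ∉ σ, L (Pi.single i 1, 0, 0) = 0) ∧ ∀ j, L (0, Pi.single j 1, 0) = 0 := by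
  constructor
  · refine fun h => ⟨fun i hi => h _ ⟨rfl, fun i' hi' => ?_⟩, fun j => h _ ⟨rfl, fun _ _ => rfl⟩⟩
    exact Pi.single_eq_of_ne (fun h : i' = i => hi (h ▸ hi')) _
  · rintro ⟨hx, hy⟩ w ⟨hq, hσ⟩
    rw [XYQ.eq_sum w]
    simp only [map_add, map_sum, map_smul, hy, hq]
    simp only [smul_zero, Finset.sum_const_zero, add_zero, Pi.zero_apply, zero_smul]
    refine Finset.sum_eq_zero fun i _ => ?_
    by_cases hi : i ∈ σ
    · simp [hσ i hi]
    · simp [hx i hi]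

/-- Trading partial derivatives for a subspace of directions gives a form that can be transported by
`dΦ`. -/
theorem mem_fiberCritical_iff {F : XYQ r k n → ℝ} {σ : Finset (Fin r)} {z : XYQ r k n} :
    z ∈ fiberCritical F σ ↔
      z ∈ corner r k n ∧ (∀ i ∈ σ, z.1 i = 0) ∧ ∀ w ∈ fiberDir r k n σ, fderiv ℝ F z w = 0 := by
  rw [forall_mem_fiberDir_iff]
  rfl

/-- The points where the second derivative of `F` is degenerate on the fiber directions. -/
def degeneratePoints (F : XYQ r k n → ℝ) (σ : Finset (Fin r)) : Set (XYQ r k n) :=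
  {z | ∃ u ∈ fiberDir r k n σ, u ≠ 0 ∧
    ∀ w ∈ fiberDir r k n σ, fderiv ℝ (fderiv ℝ F) z u w = 0}

end FiberDirections

/-! ### Adding a quadratic form in new variables -/

section Quadratic

variable {r k l n : ℕ}

/-- Forget the last `l` variables `y`. -/
noncomputable def dropY (r k l n : ℕ) : XYQ r (k + l) n →L[ℝ] XYQ r k n :=
  LinearMap.toContinuousLinearMap
    { toFun := fun z => (z.1, fun j => z.2.1 (Fin.castAdd l j), z.2.2)
      map_add' := fun _ _ => rfl
      map_smul' := fun _ _ => rfl }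

/-- The last `l` variables `y`. -/
noncomputable def lastY (r k l n : ℕ) : XYQ r (k + l) n →L[ℝ] (Fin l → ℝ) :=
  LinearMap.toContinuousLinearMap
    { toFun := fun z => fun j => z.2.1 (Fin.natAdd k j)
      map_add' := fun _ _ => rfl
      map_smul' := fun _ _ => rfl }

/-- Append `l` variables `y` with value `v`. -/
def appendY (z : XYQ r k n) (v : Fin l → ℝ) : XYQ r (k + l) n :=
  (z.1, Fin.append z.2.1 v, z.2.2)

theorem dropY_apply (z : XYQ r (k + l) n) :
    dropY r k l n z = (z.1, fun j => z.2.1 (Fin.castAdd l j), z.2.2) := rfl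

theorem lastY_apply (z : XYQ r (k + l) n) :
    lastY r k l n z = fun j => z.2.1 (Fin.natAdd k j) := rfl

theorem dropY_appendY (z : XYQ r k n) (v : Fin l → ℝ) : dropY r k l n (appendY z v) = z := by
  simp [dropY_apply, appendY]

theorem lastY_appendY (z : XYQ r k n) (v : Fin l → ℝ) : lastY r k l n (appendY z v) = v := by
  simp [lastY_apply, appendY]

theorem appendY_dropY_lastY (z : XYQ r (k + l) n) :
    appendY (dropY r k l n z) (lastY r k l n z) = z := by
  refine Prod.ext rfl (Prod.ext ?_ rfl)
  exact Fin.append_castAdd_natAdd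

theorem appendY_mem_fiberDir {σ : Finset (Fin r)} {z : XYQ r k n} (hz : z ∈ fiberDir r k n σ)
    (v : Fin l → ℝ) : appendY z v ∈ fiberDir r (k + l) n σ := hz

theorem dropY_mem_fiberDir {σ : Finset (Fin r)} {z : XYQ r (k + l) n}
    (hz : z ∈ fiberDir r (k + l) n σ) : dropY r k l n z ∈ fiberDir r k n σ := hz

theorem tendsto_appendY_zero :
    Tendsto (fun z : XYQ r k n => (appendY z 0 : XYQ r (k + l) n)) (𝓝 0) (𝓝 0) := by
  have h : Continuous (fun z : XYQ r k n => (appendY z 0 : XYQ r (k + l) n)) := by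
    unfold appendY
    refine continuous_fst.prodMk (Continuous.prodMk (continuous_pi fun j => ?_) (by fun_prop))
    refine Fin.addCases (fun j => ?_) (fun j => ?_) j
    · simp only [Fin.append_left]; fun_prop
    · simp only [Fin.append_right]; fun_prop
  have h0 : (appendY (0 : XYQ r k n) 0 : XYQ r (k + l) n) = 0 := by
    simpa using appendY_dropY_lastY (0 : XYQ r (k + l) n)
  simpa [h0] using h.tendsto 0

/-- The polar form of a quadratic form as a continuous bilinear map. -/
noncomputable def polarCLM (Q : QuadraticForm ℝ (Fin l → ℝ)) :
    (Fin l → ℝ) →L[ℝ] (Fin l → ℝ) →L[ℝ] ℝ :=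
  LinearMap.toContinuousLinearMap
    (LinearMap.toContinuousLinearMap.toLinearMap ∘ₗ QuadraticMap.polarBilin Q)

theorem polarCLM_apply (Q : QuadraticForm ℝ (Fin l → ℝ)) (u v : Fin l → ℝ) :
    polarCLM Q u v = QuadraticMap.polarBilin Q u v := rfl

/-- The polar form satisfies `polar Q y y = 2 Q y`, whence the factor `1 / 2`; the two terms of the
product rule coincide by symmetry. -/
theorem hasFDerivAt_quadraticForm (Q : QuadraticForm ℝ (Fin l → ℝ)) (y : Fin l → ℝ) :
    HasFDerivAt Q (polarCLM Q y) y := by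
  have h := ((polarCLM Q).hasFDerivAt_of_bilinear (hasFDerivAt_id y)
    (hasFDerivAt_id y)).const_mul (1 / 2 : ℝ)
  have hQ : (fun y => (1 / 2 : ℝ) * polarCLM Q (id y) (id y)) = Q := by
    funext v
    simp [polarCLM_apply, QuadraticMap.polar_self]
  rw [hQ] at h
  refine h.congr_fderiv (ContinuousLinearMap.ext fun v => ?_)
  simp [polarCLM_apply, QuadraticMap.polar_comm Q v y]
  ring

theorem contDiff_quadraticForm (Q : QuadraticForm ℝ (Fin l → ℝ)) : ContDiff ℝ ∞ Q := by
  have hQ : Q = (fun y => (1 / 2 : ℝ) * polarCLM Q y y : (Fin l → ℝ) → ℝ) := by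
    funext v
    simp [polarCLM_apply, QuadraticMap.polar_self]
  rw [hQ]
  exact contDiff_const.mul ((polarCLM Q).contDiff.clm_apply contDiff_id)

theorem addQuadratic_eq (F : XYQ r k n → ℝ) (Q : QuadraticForm ℝ (Fin l → ℝ)) :
    addQuadratic F Q = fun z => F (dropY r k l n z) + Q (lastY r k l n z) := rfl

theorem tendsto_dropY : Tendsto (dropY r k l n) (𝓝 0) (𝓝 0) := by
  simpa using (dropY r k l n).continuous.tendsto 0

theorem eventually_contDiffAt_addQuadratic {F : XYQ r k n → ℝ}
    (hF : ∀ᶠ z in 𝓝 0, ContDiffAt ℝ ∞ F z) (Q : QuadraticForm ℝ (Fin l → ℝ)) :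
    ∀ᶠ z in 𝓝 0, ContDiffAt ℝ ∞ (addQuadratic F Q) z := by
  filter_upwards [tendsto_dropY.eventually hF] with z hz
  rw [addQuadratic_eq]
  exact (hz.comp z (dropY r k l n).contDiff.contDiffAt).add
    ((contDiff_quadraticForm Q).comp (lastY r k l n).contDiff).contDiffAt

theorem fderiv_addQuadratic {F : XYQ r k n → ℝ} {z : XYQ r (k + l) n}
    (hF : DifferentiableAt ℝ F (dropY r k l n z)) (Q : QuadraticForm ℝ (Fin l → ℝ)) :
    fderiv ℝ (addQuadratic F Q) z = (fderiv ℝ F (dropY r k l n z)).comp (dropY r k l n) +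
      (polarCLM Q (lastY r k l n z)).comp (lastY r k l n) := by
  rw [addQuadratic_eq]
  exact ((hF.hasFDerivAt.comp z (dropY r k l n).hasFDerivAt).add
    ((hasFDerivAt_quadraticForm Q _).comp z (lastY r k l n).hasFDerivAt)).fderiv

/-- The Hessian is block diagonal, so the old and new variables can be tested separately. -/
theorem fderiv_fderiv_addQuadratic {F : XYQ r k n → ℝ} {z : XYQ r (k + l) n}
    (hF : ∀ᶠ w in 𝓝 (dropY r k l n z), ContDiffAt ℝ ∞ F w) (Q : QuadraticForm ℝ (Fin l → ℝ))
    (u w : XYQ r (k + l) n) :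
    fderiv ℝ (fderiv ℝ (addQuadratic F Q)) z u w =
      fderiv ℝ (fderiv ℝ F) (dropY r k l n z) (dropY r k l n u) (dropY r k l n w) +
        polarCLM Q (lastY r k l n u) (lastY r k l n w) := by
  have hev : fderiv ℝ (addQuadratic F Q) =ᶠ[𝓝 z] fun z =>
      (fderiv ℝ F (dropY r k l n z)).comp (dropY r k l n) +
        (polarCLM Q (lastY r k l n z)).comp (lastY r k l n) := by
    filter_upwards [(dropY r k l n).continuous.continuousAt.eventually hF] with z' hz'
    exact fderiv_addQuadratic (hz'.differentiableAt (by simp)) Q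
  have h1 := (hF.self_of_nhds.differentiableAt_fderiv.hasFDerivAt.comp z
    (dropY r k l n).hasFDerivAt).clm_comp (hasFDerivAt_const (dropY r k l n) z)
  have h2 := ((polarCLM Q).hasFDerivAt.comp z (lastY r k l n).hasFDerivAt).clm_comp
    (hasFDerivAt_const (lastY r k l n) z)
  rw [hev.fderiv_eq]
  refine (congrArg (fun L => L u w) (h1.add h2).fderiv).trans ?_
  simp

/-- Adding a non-degenerate quadratic form in new variables does not change the fiberwise critical
points and their degeneracy. -/
theorem isGermIso_addQuadratic {F : XYQ r k n → ℝ} (hF : ∀ᶠ z in 𝓝 0, ContDiffAt ℝ ∞ F z)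
    {Q : QuadraticForm ℝ (Fin l → ℝ)} (hQ : (QuadraticMap.polarBilin Q).Nondegenerate) :
    IsGermIso (fun z => (appendY z 0 : XYQ r (k + l) n)) (dropY r k l n)
      (fiberCritical F) (degeneratePoints F) (fun z => z.2.2)
      (fiberCritical (addQuadratic F Q)) (degeneratePoints (addQuadratic F Q)) (fun z => z.2.2)
      id where
  tendsto := tendsto_appendY_zero
  tendsto_inv := tendsto_dropY
  forward := by
    filter_upwards [hF.eventually_nhds] with z hz σ hσ
    have hz' : ∀ᶠ w in 𝓝 (dropY r k l n (appendY z 0)), ContDiffAt ℝ ∞ F w := by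
      rwa [dropY_appendY]
    have hd := hz'.self_of_nhds.differentiableAt (by simp)
    refine ⟨?_, dropY_appendY z 0, rfl, ?_⟩
    · obtain ⟨h1, h2, h3⟩ := mem_fiberCritical_iff.1 hσ
      refine mem_fiberCritical_iff.2 ⟨h1, h2, fun w hw => ?_⟩
      rw [fderiv_addQuadratic hd]
      simpa [dropY_appendY, lastY_appendY] using h3 _ (dropY_mem_fiberDir hw)
    · constructor
      · rintro ⟨u, hu, hu0, h⟩
        refine ⟨appendY u 0, appendY_mem_fiberDir hu 0, fun h0 => hu0 ?_, fun w hw => ?_⟩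
        · rw [← dropY_appendY u (0 : Fin l → ℝ), h0, map_zero]
        · rw [fderiv_fderiv_addQuadratic hz']
          simpa [dropY_appendY, lastY_appendY] using h _ (dropY_mem_fiberDir hw)
      · rintro ⟨u, hu, hu0, h⟩
        -- Testing against vectors in the new variables only leaves the polar form, so a null vector
        -- has no component there.
        have hl : lastY r k l n u = 0 := by
          refine hQ.1 _ fun v => ?_
          have := h (appendY 0 v) (appendY_mem_fiberDir (zero_mem _) v)
          rw [fderiv_fderiv_addQuadratic hz'] at this
          simpa [dropY_appendY, lastY_appendY, polarCLM_apply] using this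
        refine ⟨dropY r k l n u, dropY_mem_fiberDir hu, fun h0 => hu0 ?_, fun w hw => ?_⟩
        · rw [← appendY_dropY_lastY u, hl, h0]
          simpa using appendY_dropY_lastY (0 : XYQ r (k + l) n)
        · have := h (appendY w 0) (appendY_mem_fiberDir hw 0)
          rw [fderiv_fderiv_addQuadratic hz'] at this
          simpa [dropY_appendY, lastY_appendY] using this
  backward := by
    filter_upwards [tendsto_dropY.eventually hF] with z hz σ hσ
    have hd := hz.differentiableAt (by simp)
    obtain ⟨h1, h2, h3⟩ := mem_fiberCritical_iff.1 hσ
    rw [fderiv_addQuadratic hd] at h3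
    -- The derivative in the new variables is the polar form at `lastY z`, which vanishes only if
    -- `lastY z = 0`.
    have hl : lastY r k l n z = 0 := by
      refine hQ.1 _ fun v => ?_
      simpa [dropY_appendY, lastY_appendY, polarCLM_apply] using
        h3 (appendY 0 v) (appendY_mem_fiberDir (zero_mem _) v)
    refine ⟨mem_fiberCritical_iff.2 ⟨h1, h2, fun w hw => ?_⟩, ?_⟩
    · simpa [dropY_appendY, lastY_appendY] using h3 (appendY w 0) (appendY_mem_fiberDir hw 0)
    · conv_rhs => rw [← appendY_dropY_lastY z, hl]

end Quadratic

/-! ### One-sided derivatives and functions on the corner -/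

/-- A one-sided derivative already determines the directional derivative. Half-lines are what
remains available at boundary points of `L_σ⁰`. -/
theorem fderiv_apply_eq_zero_of_eventually {E G : Type} [NormedAddCommGroup E] [NormedSpace ℝ E]
    [NormedAddCommGroup G] [NormedSpace ℝ G] {f : E → G} {z w : E} (hf : DifferentiableAt ℝ f z)
    (h : ∀ᶠ t in 𝓝[≥] (0 : ℝ), f (z + t • w) = f z) : fderiv ℝ f z w = 0 := by
  have h1 : HasDerivWithinAt (fun t : ℝ => f (z + t • w)) (fderiv ℝ f z w) (Ici 0) 0 :=
    (hf.hasFDerivAt.hasLineDerivAt w).hasDerivWithinAt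
  have h2 : HasDerivWithinAt (fun t : ℝ => f (z + t • w)) 0 (Ici 0) 0 :=
    (hasDerivWithinAt_const (0 : ℝ) (Ici 0) (f z)).congr_of_eventuallyEq h (by simp)
  exact (uniqueDiffOn_Ici (0 : ℝ) 0 self_mem_Ici).eq_deriv _ h1 h2

theorem fderiv_eq_of_eventuallyEq_nhdsWithin {E G : Type} [NormedAddCommGroup E]
    [NormedSpace ℝ E] [NormedAddCommGroup G] [NormedSpace ℝ G] {f g : E → G} {s : Set E} {z : E}
    (hs : UniqueDiffWithinAt ℝ s z) (hz : z ∈ s) (hf : DifferentiableAt ℝ f z)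
    (hg : DifferentiableAt ℝ g z) (h : f =ᶠ[𝓝[s] z] g) : fderiv ℝ f z = fderiv ℝ g z :=
  hs.eq hf.hasFDerivAt.hasFDerivWithinAt
    (hg.hasFDerivAt.hasFDerivWithinAt.congr_of_eventuallyEq h (h.self_of_nhdsWithin hz))

/-- The corner is convex with nonempty interior, so derivatives at its boundary points are
determined by the values on it. -/
theorem uniqueDiffOn_corner (r k n : ℕ) : UniqueDiffOn ℝ (corner r k n) := by
  refine uniqueDiffOn_convex ?_ ⟨((fun _ => 1), 0, 0), ?_⟩
  · intro x hx y hy a b ha hb _ i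
    exact add_nonneg (mul_nonneg ha (hx i)) (mul_nonneg hb (hy i))
  · have ho : IsOpen {z : XYQ r k n | ∀ i, 0 < z.1 i} := by
      rw [ofPred_forall]
      exact isOpen_iInter_of_finite fun i =>
        isOpen_lt continuous_const ((continuous_apply i).comp continuous_fst)
    exact interior_maximal (fun z hz i => (hz i).le) ho (fun i => zero_lt_one)

/-- Smooth germs that agree on the corner have the same first and second derivatives there. -/
theorem eventually_fderiv_eq_of_eq_on_corner {r k n : ℕ} {G K : XYQ r k n → ℝ}
    (hG : ∀ᶠ z in 𝓝 0, ContDiffAt ℝ ∞ G z) (hK : ∀ᶠ z in 𝓝 0, ContDiffAt ℝ ∞ K z)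
    (h : ∀ᶠ z in 𝓝[corner r k n] 0, G z = K z) :
    ∀ᶠ z in 𝓝 0, z ∈ corner r k n →
      fderiv ℝ G z = fderiv ℝ K z ∧ fderiv ℝ (fderiv ℝ G) z = fderiv ℝ (fderiv ℝ K) z := by
  have h1 : ∀ᶠ z in 𝓝[corner r k n] 0, fderiv ℝ G z = fderiv ℝ K z := by
    filter_upwards [eventually_eventually_nhdsWithin.2 h, self_mem_nhdsWithin,
      hG.filter_mono nhdsWithin_le_nhds, hK.filter_mono nhdsWithin_le_nhds] with z hz hc h1 h2
    exact fderiv_eq_of_eventuallyEq_nhdsWithin (uniqueDiffOn_corner r k n z hc) hc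
      (h1.differentiableAt (by simp)) (h2.differentiableAt (by simp)) hz
  -- The first derivatives now agree on the corner near `0`, so the same uniqueness argument applies
  -- to them.
  rw [← eventually_nhdsWithin_iff]
  filter_upwards [h1, eventually_eventually_nhdsWithin.2 h1, self_mem_nhdsWithin,
    hG.filter_mono nhdsWithin_le_nhds, hK.filter_mono nhdsWithin_le_nhds] with z h1 hz hc h2 h3
  exact ⟨h1, fderiv_eq_of_eventuallyEq_nhdsWithin (uniqueDiffOn_corner r k n z hc) hc
      h2.differentiableAt_fderiv h3.differentiableAt_fderiv hz⟩

/-! ### Reticular diffeomorphisms and fiber directions -/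

/-- The linear map with kernel `fiberDir r k n σ`. -/
noncomputable def fiberCodir (r k n : ℕ) (σ : Finset (Fin r)) :
    XYQ r k n →L[ℝ] (Fin n → ℝ) × (Fin r → ℝ) :=
  LinearMap.toContinuousLinearMap
    { toFun := fun z => (z.2.2, fun i => if i ∈ σ then z.1 i else 0)
      map_add' := fun a b => by
        refine Prod.ext rfl (funext fun i => ?_)
        by_cases hi : i ∈ σ <;> simp [hi]
      map_smul' := fun c a => by
        refine Prod.ext rfl (funext fun i => ?_)
        by_cases hi : i ∈ σ <;> simp [hi] }

theorem fiberCodir_apply {r k n : ℕ} (σ : Finset (Fin r)) (z : XYQ r k n) :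
    fiberCodir r k n σ z = (z.2.2, fun i => if i ∈ σ then z.1 i else 0) := rfl

theorem fiberCodir_eq_zero_iff {r k n : ℕ} {σ : Finset (Fin r)} {z : XYQ r k n} :
    fiberCodir r k n σ z = 0 ↔ z ∈ fiberDir r k n σ := by
  rw [fiberCodir_apply, mem_fiberDir, Prod.mk_eq_zero]
  refine and_congr_right fun _ => funext_iff.trans (forall_congr' fun i => ?_)
  by_cases hi : i ∈ σ <;> simp [hi]

namespace IsReticularDiffeo

variable {r k k' n : ℕ} {Φ : DiffeoGerm (XYQ r k' n) (XYQ r k n)}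

theorem fst_eq_zero (hΦ : IsReticularDiffeo Φ) {z : XYQ r k' n} (hz : z ∈ Φ.toHomeo.source)
    {i : Fin r} (hi : z.1 i = 0) : (Φ.toHomeo z).1 i = 0 := by
  obtain ⟨φ, -, hφ⟩ := hΦ.2.1
  rw [hφ z hz i, hi, zero_mul]

/-- The special form of `Φ` enters here: its `q`-component depends on `q` alone and its
`x_i`-component is divisible by `x_i`. Hence neither `q` nor `x_σ` of the image moves along the
fiber directions from a point with `x_σ = 0`. -/
theorem fiberCodir_add (hΦ : IsReticularDiffeo Φ) {σ : Finset (Fin r)} {z w : XYQ r k' n}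
    (hz : z ∈ Φ.toHomeo.source) (hσ : ∀ i ∈ σ, z.1 i = 0) (hw : w ∈ fiberDir r k' n σ)
    (hzw : z + w ∈ Φ.toHomeo.source) :
    fiberCodir r k n σ (Φ.toHomeo (z + w)) = fiberCodir r k n σ (Φ.toHomeo z) := by
  obtain ⟨ψ, hψ⟩ := hΦ.2.2
  rw [fiberCodir_apply, fiberCodir_apply, hψ _ hz, hψ _ hzw]
  refine Prod.ext (by simp [hw.1]) (funext fun i => ?_)
  by_cases hi : i ∈ σ
  · simp [hi, hΦ.fst_eq_zero hz (hσ i hi),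
      hΦ.fst_eq_zero hzw (i := i) (by simp [hσ i hi, hw.2 i hi])]
  · simp [hi]

theorem eventually_line_mem_source (Φ : DiffeoGerm (XYQ r k' n) (XYQ r k n)) {z : XYQ r k' n}
    (hz : z ∈ Φ.toHomeo.source) (w : XYQ r k' n) :
    ∀ᶠ t in 𝓝[≥] (0 : ℝ), z + t • w ∈ Φ.toHomeo.source := by
  have hc : ContinuousAt (fun t : ℝ => z + t • w) 0 := by fun_prop
  refine (hc.eventually ?_).filter_mono nhdsWithin_le_nhds
  simpa using Φ.toHomeo.open_source.mem_nhds hz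

theorem fderiv_mem_fiberDir (hΦ : IsReticularDiffeo Φ) {σ : Finset (Fin r)} {z w : XYQ r k' n}
    (hz : z ∈ Φ.toHomeo.source) (hσ : ∀ i ∈ σ, z.1 i = 0) (hw : w ∈ fiberDir r k' n σ) :
    fderiv ℝ Φ.toHomeo z w ∈ fiberDir r k n σ := by
  have hd := (fiberCodir r k n σ).hasFDerivAt.comp z (Φ.differentiableAt hz).hasFDerivAt
  rw [← fiberCodir_eq_zero_iff]
  have := fderiv_apply_eq_zero_of_eventually (w := w) hd.differentiableAt (by
    filter_upwards [eventually_line_mem_source Φ hz w] with t ht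
    exact hΦ.fiberCodir_add hz hσ (Submodule.smul_mem _ t hw) ht)
  rw [hd.fderiv] at this
  exact this

/-- Moving the base point along `u` keeps `x_σ = 0`, so `dΦ(w)` stays in a fixed linear subspace,
and so does its derivative. This disposes of the second-derivative term of `Φ` in the Hessian of a
composite. -/
theorem fderiv_fderiv_mem_fiberDir (hΦ : IsReticularDiffeo Φ) {σ : Finset (Fin r)}
    {z u w : XYQ r k' n} (hz : z ∈ Φ.toHomeo.source) (hσ : ∀ i ∈ σ, z.1 i = 0)
    (hu : u ∈ fiberDir r k' n σ) (hw : w ∈ fiberDir r k' n σ) :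
    fderiv ℝ (fderiv ℝ Φ.toHomeo) z u w ∈ fiberDir r k n σ := by
  have hd := (fiberCodir r k n σ).hasFDerivAt.comp z
    ((Φ.contDiffAt hz).differentiableAt_fderiv.hasFDerivAt.clm_apply (hasFDerivAt_const w z))
  rw [← fiberCodir_eq_zero_iff]
  have := fderiv_apply_eq_zero_of_eventually (w := u) hd.differentiableAt (by
    filter_upwards [eventually_line_mem_source Φ hz u] with t ht
    have h1 := fiberCodir_eq_zero_iff.2 (hΦ.fderiv_mem_fiberDir hz hσ hw)
    have h2 := fiberCodir_eq_zero_iff.2 (hΦ.fderiv_mem_fiberDir ht (σ := σ)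
      (fun i hi => by simp [hσ i hi, hu.2 i hi]) hw)
    exact h2.trans h1.symm)
  rw [hd.fderiv] at this
  simpa using this

theorem eq_of_diffeoGerm (Φ : DiffeoGerm (XYQ r k' n) (XYQ r k n)) : k' = k := by
  have h := (LinearEquiv.ofBijective (fderiv ℝ Φ.toHomeo 0 : XYQ r k' n →ₗ[ℝ] XYQ r k n)
    ⟨Φ.fderiv_injective Φ.zero_mem, fun v =>
      ⟨_, Φ.fderiv_comp_fderiv_symm Φ.zero_mem v⟩⟩).finrank_eq
  simp only [Module.finrank_prod, Module.finrank_fin_fun] at h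
  omega

/-- The differential restricts to an injective map between spaces of fiber directions; since the
numbers of variables agree, this is an endomorphism in finite dimension, hence onto. -/
theorem exists_fderiv_eq (hΦ : IsReticularDiffeo Φ) {σ : Finset (Fin r)} {z : XYQ r k' n}
    (hz : z ∈ Φ.toHomeo.source) (hσ : ∀ i ∈ σ, z.1 i = 0) {v : XYQ r k n}
    (hv : v ∈ fiberDir r k n σ) : ∃ w ∈ fiberDir r k' n σ, fderiv ℝ Φ.toHomeo z w = v := by
  obtain rfl := eq_of_diffeoGerm Φ
  let L := (fderiv ℝ Φ.toHomeo z : XYQ r k' n →ₗ[ℝ] XYQ r k' n).restrict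
    (p := fiberDir r k' n σ) (q := fiberDir r k' n σ)
    fun w hw => hΦ.fderiv_mem_fiberDir hz hσ hw
  have hL : Function.Injective L := fun a b hab =>
    Subtype.ext (Φ.fderiv_injective hz (congrArg Subtype.val hab))
  obtain ⟨w, hw⟩ := LinearMap.injective_iff_surjective.1 hL ⟨v, hv⟩
  exact ⟨w, w.2, congrArg Subtype.val hw⟩

/-- If `φ_i(0) = 0`, the differential of `x_i φ_i` would vanish at `0`; but it is the `i`-th
coordinate of the surjective `dΦ`. So `φ_i` has no zero near `0`. -/
theorem eventually_fst_eq_zero_iff (hΦ : IsReticularDiffeo Φ) :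
    ∀ᶠ z in 𝓝 0, ∀ i, (Φ.toHomeo z).1 i = 0 ↔ z.1 i = 0 := by
  obtain ⟨φ, hφs, hφ⟩ := hΦ.2.1
  rw [eventually_all]
  intro i
  have hc : ContDiffAt ℝ ∞ φ 0 := hφs.contDiffAt Φ.source_mem
  have hd : DifferentiableAt ℝ (fun z => φ z i) 0 :=
    differentiableAt_pi.1 (hc.differentiableAt (by simp)) i
  have h0 : φ 0 i ≠ 0 := by
    intro h0
    let ℓ : XYQ r k n →L[ℝ] ℝ :=
      (ContinuousLinearMap.proj i).comp (ContinuousLinearMap.fst ℝ (Fin r → ℝ) _)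
    let ℓ' : XYQ r k' n →L[ℝ] ℝ :=
      (ContinuousLinearMap.proj i).comp (ContinuousLinearMap.fst ℝ (Fin r → ℝ) _)
    have h1 := ℓ.hasFDerivAt.comp 0 (Φ.differentiableAt Φ.zero_mem).hasFDerivAt
    have h2 := ℓ'.hasFDerivAt.mul hd.hasFDerivAt
    have h3 := h1.congr_of_eventuallyEq (f₁ := fun z => ℓ' z * φ z i) (by
      filter_upwards [Φ.source_mem] with z hz
      exact (hφ z hz i).symm)
    have h4 := h3.unique h2
    have h5 := DFunLike.congr_fun h4
      (fderiv ℝ Φ.toHomeo.symm (Φ.toHomeo 0) (Pi.single i 1, 0, 0))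
    simp only [ContinuousLinearMap.comp_apply, Φ.fderiv_comp_fderiv_symm Φ.zero_mem] at h5
    simp [ℓ, h0] at h5
  filter_upwards [hd.continuousAt.eventually_ne h0, Φ.source_mem] with z hz hs
  rw [hφ z hs i, mul_eq_zero, or_iff_left hz]

end IsReticularDiffeo

/-! ### Invariance under `G = a · H ∘ Φ + b` -/

section PCEquivalence

variable {r k k' n : ℕ} {Φ : DiffeoGerm (XYQ r k' n) (XYQ r k n)} {H : XYQ r k n → ℝ}
  {a b : (Fin n → ℝ) → ℝ}

/-- Along vectors with zero `q`-component, `a` and `b` are constant and only `H ∘ Φ` is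
differentiated. -/
theorem fderiv_mul_comp_add_apply {z w : XYQ r k' n} (hz : z ∈ Φ.toHomeo.source)
    (hH : DifferentiableAt ℝ H (Φ.toHomeo z)) (ha : DifferentiableAt ℝ a z.2.2)
    (hb : DifferentiableAt ℝ b z.2.2) (hw : w.2.2 = 0) :
    fderiv ℝ (fun z : XYQ r k' n => a z.2.2 * H (Φ.toHomeo z) + b z.2.2) z w =
      a z.2.2 * fderiv ℝ H (Φ.toHomeo z) (fderiv ℝ Φ.toHomeo z w) := by
  have hq : HasFDerivAt (fun z : XYQ r k' n => z.2.2) _ z :=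
    ((ContinuousLinearMap.snd ℝ (Fin k' → ℝ) (Fin n → ℝ)).comp
      (ContinuousLinearMap.snd ℝ (Fin r → ℝ) _)).hasFDerivAt
  have h := ((ha.hasFDerivAt.comp z hq).mul
    (hH.hasFDerivAt.comp z (Φ.differentiableAt hz).hasFDerivAt)).add (hb.hasFDerivAt.comp z hq)
  refine (congrArg (fun L => L w) h.fderiv).trans ?_
  simp [hw]

theorem fderiv_fderiv_mul_comp_add_apply {z u w : XYQ r k' n} (hz : z ∈ Φ.toHomeo.source)
    (hH : ∀ᶠ y in 𝓝 (Φ.toHomeo z), ContDiffAt ℝ ∞ H y) (ha : ∀ᶠ q in 𝓝 z.2.2, ContDiffAt ℝ ∞ a q)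
    (hb : ∀ᶠ q in 𝓝 z.2.2, ContDiffAt ℝ ∞ b q) (hu : u.2.2 = 0) (hw : w.2.2 = 0) :
    fderiv ℝ (fderiv ℝ (fun z : XYQ r k' n => a z.2.2 * H (Φ.toHomeo z) + b z.2.2)) z u w =
      a z.2.2 * (fderiv ℝ (fderiv ℝ H) (Φ.toHomeo z) (fderiv ℝ Φ.toHomeo z u)
          (fderiv ℝ Φ.toHomeo z w) +
        fderiv ℝ H (Φ.toHomeo z) (fderiv ℝ (fderiv ℝ Φ.toHomeo) z u w)) := by
  have hqc : ContinuousAt (fun z : XYQ r k' n => z.2.2) z := by fun_prop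
  have hq : HasFDerivAt (fun z : XYQ r k' n => z.2.2) _ z :=
    ((ContinuousLinearMap.snd ℝ (Fin k' → ℝ) (Fin n → ℝ)).comp
      (ContinuousLinearMap.snd ℝ (Fin r → ℝ) _)).hasFDerivAt
  have hK : ContDiffAt ℝ ∞ (fun z : XYQ r k' n => a z.2.2 * H (Φ.toHomeo z) + b z.2.2) z :=
    ((ha.self_of_nhds.comp z (by fun_prop)).mul
      (hH.self_of_nhds.comp z (Φ.contDiffAt hz))).add (hb.self_of_nhds.comp z (by fun_prop))
  have h1 := hK.differentiableAt_fderiv.hasFDerivAt.clm_apply (hasFDerivAt_const w z)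
  have hev : (fun z => fderiv ℝ
        (fun z : XYQ r k' n => a z.2.2 * H (Φ.toHomeo z) + b z.2.2) z w) =ᶠ[𝓝 z]
      fun z => a z.2.2 * fderiv ℝ H (Φ.toHomeo z) (fderiv ℝ Φ.toHomeo z w) := by
    filter_upwards [Φ.toHomeo.open_source.mem_nhds hz, hqc.eventually ha, hqc.eventually hb,
      (Φ.toHomeo.continuousAt hz).eventually hH] with z' h1 h2 h3 h4
    exact fderiv_mul_comp_add_apply h1 (h4.differentiableAt (by simp))
      (h2.differentiableAt (by simp)) (h3.differentiableAt (by simp)) hw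
  have h2 := ((ha.self_of_nhds.differentiableAt (by simp)).hasFDerivAt.comp z hq).mul
    ((hH.self_of_nhds.differentiableAt_fderiv.hasFDerivAt.comp z
      (Φ.differentiableAt hz).hasFDerivAt).clm_apply
    ((Φ.contDiffAt hz).differentiableAt_fderiv.hasFDerivAt.clm_apply (hasFDerivAt_const w z)))
  have h3 := DFunLike.congr_fun (h1.unique (h2.congr_of_eventuallyEq hev)) u
  simp [hu] at h3
  rw [h3]
  ring

/-- A reticular `𝒫`-`𝒞`-equivalence matches the fiberwise critical points and their degeneracy. -/
theorem isGermIso_of_eq_mul_comp_add {G : XYQ r k' n → ℝ} {ψ : (Fin n → ℝ) → (Fin n → ℝ)}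
    (hΦ : IsReticularDiffeo Φ) (hψ : ∀ z ∈ Φ.toHomeo.source, (Φ.toHomeo z).2.2 = ψ z.2.2)
    (ha : ∀ᶠ q in 𝓝 0, ContDiffAt ℝ ∞ a q) (ha0 : a 0 ≠ 0) (hb : ∀ᶠ q in 𝓝 0, ContDiffAt ℝ ∞ b q)
    (hH : ∀ᶠ z in 𝓝 0, ContDiffAt ℝ ∞ H z) (hG : ∀ᶠ z in 𝓝 0, ContDiffAt ℝ ∞ G z)
    (h : ∀ᶠ z in 𝓝[corner r k' n] 0, G z = a z.2.2 * H (Φ.toHomeo z) + b z.2.2) :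
    IsGermIso Φ.toHomeo Φ.toHomeo.symm (fiberCritical G) (degeneratePoints G) (fun z => z.2.2)
      (fiberCritical H) (degeneratePoints H) (fun z => z.2.2) ψ := by
  have hq : Tendsto (fun z : XYQ r k' n => z.2.2) (𝓝 0) (𝓝 0) := by
    have : Continuous (fun z : XYQ r k' n => z.2.2) := by fun_prop
    exact this.tendsto 0
  have hK : ∀ᶠ z in 𝓝 0,
      ContDiffAt ℝ ∞ (fun z : XYQ r k' n => a z.2.2 * H (Φ.toHomeo z) + b z.2.2) z := by
    filter_upwards [hq.eventually ha, hq.eventually hb, Φ.tendsto.eventually hH, Φ.source_mem]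
      with z h1 h2 h3 h4
    exact ((h1.comp z (by fun_prop)).mul (h3.comp z (Φ.contDiffAt h4))).add
      (h2.comp z (by fun_prop))
  have hcrit : ∀ᶠ z in 𝓝 0, ∀ σ, z ∈ fiberCritical G σ ↔ Φ.toHomeo z ∈ fiberCritical H σ := by
    filter_upwards [Φ.source_mem, eventually_fderiv_eq_of_eq_on_corner hG hK h,
      hΦ.eventually_fst_eq_zero_iff, hq.eventually ha, hq.eventually hb,
      Φ.tendsto.eventually hH, hq.eventually (ha.self_of_nhds.continuousAt.eventually_ne ha0)]
      with z hz hGK hx ha hb hH ha0 σ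
    rw [mem_fiberCritical_iff, mem_fiberCritical_iff, ← hΦ.1 z hz]
    refine and_congr_right fun hc => ?_
    simp only [hx]
    refine and_congr_right fun hσ => ?_
    have hd : ∀ w ∈ fiberDir r k' n σ, fderiv ℝ G z w =
        a z.2.2 * fderiv ℝ H (Φ.toHomeo z) (fderiv ℝ Φ.toHomeo z w) := fun w hw => by
      rw [(hGK hc).1]
      exact fderiv_mul_comp_add_apply hz (hH.differentiableAt (by simp))
        (ha.differentiableAt (by simp)) (hb.differentiableAt (by simp)) hw.1
    constructor
    · intro h v hv
      obtain ⟨w, hw, rfl⟩ := hΦ.exists_fderiv_eq hz hσ hv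
      have := h w hw
      rw [hd w hw] at this
      exact (mul_eq_zero.1 this).resolve_left ha0
    · intro h w hw
      rw [hd w hw, h _ (hΦ.fderiv_mem_fiberDir hz hσ hw), mul_zero]
  refine ⟨Φ.tendsto, Φ.tendsto_symm, ?_, ?_⟩
  · filter_upwards [hcrit, Φ.source_mem, eventually_fderiv_eq_of_eq_on_corner hG hK h,
      hq.eventually ha.eventually_nhds, hq.eventually hb.eventually_nhds,
      Φ.tendsto.eventually hH.eventually_nhds,
      hq.eventually (ha.self_of_nhds.continuousAt.eventually_ne ha0)]
      with z hcrit hz hGK ha hb hH ha0 σ hzσ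
    have hΦz := (hcrit σ).1 hzσ
    refine ⟨hΦz, Φ.toHomeo.left_inv hz, hψ z hz, ?_⟩
    obtain ⟨hc, hσ, -⟩ := mem_fiberCritical_iff.1 hzσ
    -- The term with the second derivative of `Φ` drops out: it is `dH` applied to a fiber direction
    -- at the critical point `Φ z`.
    have hd : ∀ u ∈ fiberDir r k' n σ, ∀ w ∈ fiberDir r k' n σ, fderiv ℝ (fderiv ℝ G) z u w =
        a z.2.2 * fderiv ℝ (fderiv ℝ H) (Φ.toHomeo z) (fderiv ℝ Φ.toHomeo z u)
          (fderiv ℝ Φ.toHomeo z w) := fun u hu w hw => by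
      rw [(hGK hc).2, fderiv_fderiv_mul_comp_add_apply hz hH ha hb hu.1 hw.1,
        (mem_fiberCritical_iff.1 hΦz).2.2 _ (hΦ.fderiv_fderiv_mem_fiberDir hz hσ hu hw), add_zero]
    constructor
    · rintro ⟨u, hu, hu0, hdeg⟩
      refine ⟨fderiv ℝ Φ.toHomeo z u, hΦ.fderiv_mem_fiberDir hz hσ hu,
        fun h0 => hu0 (Φ.fderiv_injective hz (by rw [h0, map_zero])), fun v hv => ?_⟩
      obtain ⟨w, hw, rfl⟩ := hΦ.exists_fderiv_eq hz hσ hv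
      have := hdeg w hw
      rw [hd u hu w hw] at this
      exact (mul_eq_zero.1 this).resolve_left ha0
    · rintro ⟨v, hv, hv0, hdeg⟩
      obtain ⟨u, hu, rfl⟩ := hΦ.exists_fderiv_eq hz hσ hv
      refine ⟨u, hu, fun h0 => hv0 (by rw [h0, map_zero]), fun w hw => ?_⟩
      rw [hd u hu w hw, hdeg _ (hΦ.fderiv_mem_fiberDir hz hσ hw), mul_zero]
  · filter_upwards [Φ.tendsto_symm.eventually hcrit, Φ.target_mem] with z hz ht σ hσ
    have hr := Φ.toHomeo.right_inv ht
    exact ⟨(hz σ).2 (by rwa [hr]), hr⟩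

end PCEquivalence

/-! ### The induced diffeomorphism of the base -/

section Base

/-- The inverse function theorem for germs of smooth maps. -/
theorem exists_diffeoGerm_leftInverse {E : Type} [NormedAddCommGroup E] [NormedSpace ℝ E]
    [CompleteSpace E] {f : E → E} (hf : ∀ᶠ q in 𝓝 0, ContDiffAt ℝ ∞ f q) (hf0 : f 0 = 0)
    (f' : E ≃L[ℝ] E) (hf' : HasFDerivAt f (f' : E →L[ℝ] E) 0) :
    ∃ g : DiffeoGerm E E, ∀ᶠ q in 𝓝 0, g.toHomeo (f q) = q := by
  have h0 := hf.self_of_nhds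
  let e₀ := h0.toOpenPartialHomeomorph f hf' (by simp)
  have he₀ : (e₀ : E → E) = f := rfl
  have hs : (0 : E) ∈ e₀.source := h0.mem_toOpenPartialHomeomorph_source hf' (by simp)
  have hinv : ∀ᶠ q in 𝓝 (0 : E), fderiv ℝ f q ∈ range ((↑) : (E ≃L[ℝ] E) → E →L[ℝ] E) := by
    have hc : ContinuousAt (fderiv ℝ f) 0 := h0.differentiableAt_fderiv.continuousAt
    refine hc.eventually (ContinuousLinearEquiv.isOpen.mem_nhds ⟨f', hf'.fderiv.symm⟩)
  -- The domain is shrunk until `f` is smooth with invertible differential throughout, which makes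
  -- the inverse smooth on the whole target.
  obtain ⟨O, hO, hOo, h0O⟩ := mem_nhds_iff.1 (hf.and hinv)
  let e := e₀.restrOpen O hOo
  have hes : e.source = e₀.source ∩ O := rfl
  have hef : (e : E → E) = f := rfl
  refine ⟨⟨e.symm, ?_, ?_, ?_, ?_⟩, ?_⟩
  · have := e.map_source (show (0 : E) ∈ e.source from ⟨hs, h0O⟩)
    rwa [hef, hf0] at this
  · have := e.left_inv (show (0 : E) ∈ e.source from ⟨hs, h0O⟩)
    rwa [hef, hf0] at this
  · intro y hy
    have hy' : y ∈ e.target := hy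
    have hz := hO (e.map_target hy').2
    obtain ⟨L, hL⟩ := hz.2
    refine (e.contDiffAt_symm (f₀' := L) hy' ?_ hz.1).contDiffWithinAt
    rw [hL]
    exact (hz.1.differentiableAt (by simp)).hasFDerivAt
  · intro y hy
    exact (hO (show y ∈ e.source from hy).2).1.contDiffWithinAt
  · filter_upwards [e.open_source.mem_nhds (show (0 : E) ∈ e.source from ⟨hs, h0O⟩)] with q hq
    exact e.left_inv hq

/-- The base component of a fibered diffeomorphism germ is invertible. -/
theorem exists_diffeoGerm_of_fibered {r k k' n : ℕ} {Φ : DiffeoGerm (XYQ r k' n) (XYQ r k n)}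
    {ψ : (Fin n → ℝ) → (Fin n → ℝ)}
    (hψ : ∀ z ∈ Φ.toHomeo.source, (Φ.toHomeo z).2.2 = ψ z.2.2) :
    ∃ g : DiffeoGerm (Fin n → ℝ) (Fin n → ℝ), ∀ᶠ q in 𝓝 0, g.toHomeo (ψ q) = q := by
  have hi : Tendsto (fun q : Fin n → ℝ => ((0, 0, q) : XYQ r k' n)) (𝓝 0) (𝓝 0) := by
    have : Continuous (fun q : Fin n → ℝ => ((0, 0, q) : XYQ r k' n)) := by fun_prop
    exact this.tendsto 0
  have hsm : ∀ᶠ q in 𝓝 0, ContDiffAt ℝ ∞ ψ q := by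
    -- Nothing is assumed about the regularity of `ψ`; it is recovered from `Φ` on the slice `x =
    -- 0`, `y = 0`.
    have hev : ∀ᶠ q in 𝓝 0, ψ q = (Φ.toHomeo ((0, 0, q) : XYQ r k' n)).2.2 := by
      filter_upwards [hi Φ.source_mem] with q hq
      exact (hψ _ hq).symm
    filter_upwards [hev.eventually_nhds, hi Φ.source_mem] with q hq hs
    refine ContDiffAt.congr_of_eventuallyEq ?_ hq
    have h1 : ContDiffAt ℝ ∞ (fun q : Fin n → ℝ => ((0, 0, q) : XYQ r k' n)) q := by fun_prop
    exact (ContDiffAt.comp q (Φ.contDiffAt hs) h1).snd.snd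
  have h00 : ψ 0 = 0 := by
    have := hψ 0 Φ.zero_mem
    rw [Φ.map_zero] at this
    exact this.symm
  have hd := (hsm.self_of_nhds.differentiableAt (by simp)).hasFDerivAt
  -- Differentiating `ψ ∘ pr_q = pr_q ∘ Φ` shows that `dψ` after the projection is onto, hence `dψ`
  -- is onto.
  have hsurj : Function.Surjective (fderiv ℝ ψ 0) := by
    intro v
    let ℓ : ∀ m, XYQ r m n →L[ℝ] (Fin n → ℝ) := fun m =>
      (ContinuousLinearMap.snd ℝ (Fin m → ℝ) (Fin n → ℝ)).comp
        (ContinuousLinearMap.snd ℝ (Fin r → ℝ) _)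
    have h1 := (ℓ k).hasFDerivAt.comp 0 (Φ.differentiableAt Φ.zero_mem).hasFDerivAt
    have h2 : HasFDerivAt (ψ ∘ ℓ k') _ 0 := HasFDerivAt.comp 0 hd (ℓ k').hasFDerivAt
    have h3 := h1.congr_of_eventuallyEq (f₁ := ψ ∘ ℓ k') (by
      filter_upwards [Φ.source_mem] with z hz
      exact (hψ z hz).symm)
    have h5 := DFunLike.congr_fun (h3.unique h2)
      (fderiv ℝ Φ.toHomeo.symm (Φ.toHomeo 0) (0, 0, v))
    simp only [ContinuousLinearMap.comp_apply, Φ.fderiv_comp_fderiv_symm Φ.zero_mem] at h5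
    exact ⟨_, h5.symm⟩
  have hinj : Function.Injective (fderiv ℝ ψ 0) :=
    (LinearMap.injective_iff_surjective (f := (fderiv ℝ ψ 0 : (Fin n → ℝ) →ₗ[ℝ] _))).2 hsurj
  let f' : (Fin n → ℝ) ≃L[ℝ] (Fin n → ℝ) := (LinearEquiv.ofBijective
    (fderiv ℝ ψ 0 : (Fin n → ℝ) →ₗ[ℝ] (Fin n → ℝ)) ⟨hinj, hsurj⟩).toContinuousLinearEquiv
  exact exists_diffeoGerm_leftInverse hsm h00 f' hd

end Base

/-! ### Left inverses of immersions -/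

section Immersion

/-- A smooth germ with injective differential has a smooth left inverse. -/
theorem exists_leftInverse_of_fderiv_injective {E G : Type} [NormedAddCommGroup E]
    [NormedSpace ℝ E] [FiniteDimensional ℝ E] [NormedAddCommGroup G] [NormedSpace ℝ G]
    [FiniteDimensional ℝ G] {J : E → G} (hJ : ContDiffAt ℝ ∞ J 0) (hJ0 : J 0 = 0)
    (hinj : Function.Injective (fderiv ℝ J 0)) :
    ∃ ρ : G → E, ContDiffAt ℝ ∞ ρ 0 ∧ ρ 0 = 0 ∧ ∀ᶠ z in 𝓝 0, ρ (J z) = z := by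
  have := FiniteDimensional.complete ℝ E
  -- With a linear left inverse `K` of `dJ`, the map `K ∘ J` has identity differential at `0`; its
  -- local inverse after `K` is the required map.
  obtain ⟨K₀, hK₀⟩ := LinearMap.exists_leftInverse_of_injective
    (fderiv ℝ J 0 : E →ₗ[ℝ] G) (LinearMap.ker_eq_bot.2 hinj)
  let K : G →L[ℝ] E := LinearMap.toContinuousLinearMap K₀
  have hf : ContDiffAt ℝ ∞ (K ∘ J) 0 := K.contDiff.contDiffAt.comp 0 hJ
  have hf' : HasFDerivAt (K ∘ J) ((ContinuousLinearEquiv.refl ℝ E : E ≃L[ℝ] E) : E →L[ℝ] E) 0 := by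
    refine (K.hasFDerivAt.comp 0 (hJ.differentiableAt (by simp)).hasFDerivAt).congr_fderiv ?_
    refine ContinuousLinearMap.ext fun v => ?_
    exact LinearMap.congr_fun hK₀ v
  have h0 : (K ∘ J) 0 = 0 := by simp [hJ0]
  have hρ := hf.to_localInverse hf' (by simp)
  have hρ0 := hf.localInverse_apply_image hf' (by simp)
  rw [h0] at hρ hρ0
  refine ⟨hf.localInverse hf' (by simp) ∘ K, ?_, by simp [hρ0], ?_⟩
  · refine ContDiffAt.comp 0 ?_ K.contDiff.contDiffAt
    simpa using hρ
  · exact (hf.hasStrictFDerivAt' hf' (by simp)).eventually_left_inverse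

end Immersion

/-! ### Consequences of non-degeneracy of the family -/

section GeneratingFamily

variable {r k n : ℕ} {F : XYQ r k n → ℝ}

theorem hasFDerivAt_fderiv_apply {z : XYQ r k n} (hF : ContDiffAt ℝ ∞ F z) (w : XYQ r k n) :
    HasFDerivAt (fun z => fderiv ℝ F z w) ((fderiv ℝ (fderiv ℝ F) z).flip w) z := by
  refine (hF.differentiableAt_fderiv.hasFDerivAt.clm_apply (hasFDerivAt_const w z)).congr_fderiv ?_
  refine ContinuousLinearMap.ext fun u => ?_
  simp

theorem fderiv_dX {z : XYQ r k n} (hF : ContDiffAt ℝ ∞ F z) (i : Fin r) :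
    fderiv ℝ (dX F i) z = (fderiv ℝ (fderiv ℝ F) z).flip (Pi.single i 1, 0, 0) :=
  (hasFDerivAt_fderiv_apply hF _).fderiv

theorem fderiv_dY {z : XYQ r k n} (hF : ContDiffAt ℝ ∞ F z) (j : Fin k) :
    fderiv ℝ (dY F j) z = (fderiv ℝ (fderiv ℝ F) z).flip (0, Pi.single j 1, 0) :=
  (hasFDerivAt_fderiv_apply hF _).fderiv

theorem fderiv_coordX (i : Fin r) (z : XYQ r k n) :
    fderiv ℝ (fun z : XYQ r k n => z.1 i) z =
      (ContinuousLinearMap.proj i).comp (ContinuousLinearMap.fst ℝ (Fin r → ℝ) _) :=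
  ((ContinuousLinearMap.proj (R := ℝ) (φ := fun _ : Fin r => ℝ) i).comp
    (ContinuousLinearMap.fst ℝ (Fin r → ℝ) ((Fin k → ℝ) × (Fin n → ℝ)))).hasFDerivAt.fderiv

/-- The map `(x, y, q) ↦ (q, ∂F/∂q)`. -/
noncomputable def toCotangent (F : XYQ r k n → ℝ) (z : XYQ r k n) : Cotangent n :=
  (z.2.2, dQ F z)

theorem toCotangent_zero (hF0 : fderiv ℝ F 0 = 0) : toCotangent F 0 = 0 :=
  Prod.ext rfl (funext fun l => by simp [toCotangent, dQ, hF0])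

theorem contDiffAt_toCotangent {z : XYQ r k n} (hF : ContDiffAt ℝ ∞ F z) :
    ContDiffAt ℝ ∞ (toCotangent F) z := by
  have hF' : ContDiffAt ℝ ∞ (fderiv ℝ F) z := hF.fderiv_right (m := ∞) (by simp)
  refine ContDiffAt.prodMk (by fun_prop) (contDiffAt_pi.2 fun l => ?_)
  exact hF'.clm_apply contDiffAt_const

theorem fderiv_toCotangent_fst {z : XYQ r k n} (hF : ContDiffAt ℝ ∞ F z) (u : XYQ r k n) :
    (fderiv ℝ (toCotangent F) z u).1 = u.2.2 := by
  have h1 := (ContinuousLinearMap.fst ℝ (Fin n → ℝ) (Fin n → ℝ)).hasFDerivAt.comp z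
    ((contDiffAt_toCotangent hF).differentiableAt (by simp)).hasFDerivAt
  have h2 : HasFDerivAt (fun z : XYQ r k n => z.2.2) _ z :=
    ((ContinuousLinearMap.snd ℝ (Fin k → ℝ) (Fin n → ℝ)).comp
      (ContinuousLinearMap.snd ℝ (Fin r → ℝ) _)).hasFDerivAt
  exact DFunLike.congr_fun (h1.unique h2) u

/-- By the hypotheses, `D²F(u, ·)` is a combination of the `dx_i`. As `u` has no `q`-component,
`D²F(·, u)` is the combination of the `d(∂F/∂x_i)` and `d(∂F/∂y_j)` whose coefficients are the
coordinates of `u`. Symmetry of `D²F` equates the two, a linear relation among independent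
differentials, so these coordinates vanish. -/
theorem eq_zero_of_sNondegenerate (hF : ContDiffAt ℝ ∞ F 0) (hN : SNondegenerate F)
    {u : XYQ r k n} (hq : u.2.2 = 0)
    (hQ : ∀ l, fderiv ℝ (fderiv ℝ F) 0 u (0, 0, Pi.single l 1) = 0)
    (hY : ∀ j, fderiv ℝ (fderiv ℝ F) 0 u (0, Pi.single j 1, 0) = 0) : u = 0 := by
  have hsymm : ∀ v w, fderiv ℝ (fderiv ℝ F) 0 v w = fderiv ℝ (fderiv ℝ F) 0 w v :=
    hF.isSymmSndFDerivAt (by simpa using WithTop.coe_le_coe.2 (le_top : (2 : ℕ∞) ≤ ⊤))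
  have h := Fintype.linearIndependent_iff.1 hN
    (Sum.elim (fun i => -fderiv ℝ (fderiv ℝ F) 0 u (Pi.single i 1, 0, 0)) (Sum.elim u.1 u.2.1)) (by
      refine ContinuousLinearMap.ext fun w => ?_
      have h1 : fderiv ℝ (fderiv ℝ F) 0 u w =
          ∑ i, w.1 i * fderiv ℝ (fderiv ℝ F) 0 u (Pi.single i 1, 0, 0) := by
        conv_lhs => rw [XYQ.eq_sum w]
        simp only [map_add, map_sum, map_smul, hQ, hY, smul_eq_mul, mul_zero,
          Finset.sum_const_zero, add_zero]
      have h2 : fderiv ℝ (fderiv ℝ F) 0 w u =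
          ∑ i, u.1 i * fderiv ℝ (fderiv ℝ F) 0 w (Pi.single i 1, 0, 0) +
            ∑ j, u.2.1 j * fderiv ℝ (fderiv ℝ F) 0 w (0, Pi.single j 1, 0) := by
        conv_lhs => rw [XYQ.eq_sum u]
        simp only [map_add, map_sum, map_smul, hq, smul_eq_mul, Pi.zero_apply, zero_mul,
          Finset.sum_const_zero, add_zero]
      have h3 : ∑ i, fderiv ℝ (fderiv ℝ F) 0 u (Pi.single i 1, 0, 0) * w.1 i =
          fderiv ℝ (fderiv ℝ F) 0 u w := by
        rw [h1]
        exact Finset.sum_congr rfl fun i _ => mul_comm _ _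
      simp only [Fintype.sum_sum_type, Sum.elim_inl, Sum.elim_inr, fderiv_dX hF, fderiv_dY hF,
        fderiv_coordX]
      simp [Finset.sum_neg_distrib, h3, ← h2, hsymm w u])
  refine Prod.ext (funext fun i => ?_) (Prod.ext (funext fun j => ?_) hq)
  · exact h (Sum.inr (Sum.inl i))
  · exact h (Sum.inr (Sum.inr j))

/-- On `∂F/∂y = 0` the point `(x, y, q)` is a smooth function of `(q, ∂F/∂q)`. -/
theorem exists_leftInverse_toCotangent (hF : ContDiffAt ℝ ∞ F 0) (hF0 : fderiv ℝ F 0 = 0)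
    (hN : SNondegenerate F) :
    ∃ ρ : Cotangent n → XYQ r k n, ContDiffAt ℝ ∞ ρ 0 ∧ ρ 0 = 0 ∧
      ∀ᶠ z in 𝓝 0, (∀ j, dY F j z = 0) → ρ (toCotangent F z) = z := by
  -- Adjoining `∂F/∂y` to `(q, ∂F/∂q)` gives an immersion at `0`; its left inverse is then
  -- restricted to the slice where the adjoined component is zero.
  let J : XYQ r k n → Cotangent n × (Fin k → ℝ) := fun z => (toCotangent F z, fun j => dY F j z)
  have hF' : ContDiffAt ℝ ∞ (fderiv ℝ F) 0 := hF.fderiv_right (m := ∞) (by simp)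
  have hJ : ContDiffAt ℝ ∞ J 0 := by
    refine (contDiffAt_toCotangent hF).prodMk (contDiffAt_pi.2 fun j => ?_)
    exact hF'.clm_apply contDiffAt_const
  have hJ0 : J 0 = 0 :=
    Prod.ext (toCotangent_zero hF0) (funext fun j => by simp [J, dY, hF0])
  have hd : ∀ (ℓ : Cotangent n × (Fin k → ℝ) →L[ℝ] ℝ) (w : XYQ r k n),
      (∀ z, ℓ (J z) = fderiv ℝ F z w) → ∀ u, ℓ (fderiv ℝ J 0 u) = fderiv ℝ (fderiv ℝ F) 0 u w := by
    intro ℓ w h u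
    have h1 := ℓ.hasFDerivAt.comp 0 (hJ.differentiableAt (by simp)).hasFDerivAt
    rw [show ℓ ∘ J = fun z => fderiv ℝ F z w from funext h] at h1
    exact DFunLike.congr_fun (h1.unique (hasFDerivAt_fderiv_apply hF w)) u
  have hinj : Function.Injective (fderiv ℝ J 0) := by
    refine (injective_iff_map_eq_zero _).2 fun u hu => eq_zero_of_sNondegenerate hF hN ?_ ?_ ?_
    · have h1 := ((ContinuousLinearMap.fst ℝ (Fin n → ℝ) (Fin n → ℝ)).comp
        (ContinuousLinearMap.fst ℝ (Cotangent n) (Fin k → ℝ))).hasFDerivAt.comp 0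
        (hJ.differentiableAt (by simp)).hasFDerivAt
      have h2 : HasFDerivAt (fun z : XYQ r k n => z.2.2) _ 0 :=
        ((ContinuousLinearMap.snd ℝ (Fin k → ℝ) (Fin n → ℝ)).comp
          (ContinuousLinearMap.snd ℝ (Fin r → ℝ) _)).hasFDerivAt
      have h3 := DFunLike.congr_fun (h1.unique h2) u
      simp only [ContinuousLinearMap.comp_apply, hu, map_zero] at h3
      exact h3.symm
    · intro l
      rw [← hd (((ContinuousLinearMap.proj l).comp
        (ContinuousLinearMap.snd ℝ (Fin n → ℝ) (Fin n → ℝ))).comp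
        (ContinuousLinearMap.fst ℝ (Cotangent n) (Fin k → ℝ))) _ (fun z => rfl) u, hu, map_zero]
    · intro j
      rw [← hd ((ContinuousLinearMap.proj j).comp
        (ContinuousLinearMap.snd ℝ (Cotangent n) (Fin k → ℝ))) _ (fun z => rfl) u, hu, map_zero]
  obtain ⟨ρ, hρ, hρ0, hρJ⟩ := exists_leftInverse_of_fderiv_injective hJ hJ0 hinj
  refine ⟨fun c => ρ (c, 0), ContDiffAt.comp (g := ρ) (f := fun c : Cotangent n => (c, 0)) 0 hρ
    (by fun_prop), hρ0, ?_⟩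
  filter_upwards [hρJ] with z hz hy
  rw [show J z = (toCotangent F z, 0) from Prod.ext rfl (funext hy)] at hz
  exact hz

/-- The common kernel of the differentials at `z` of the equations `x_σ = 0`,
`∂F/∂x_{I_r - σ} = 0`, `∂F/∂y = 0`. -/
def criticalTangent (F : XYQ r k n → ℝ) (σ : Finset (Fin r)) (z : XYQ r k n) :
    Submodule ℝ (XYQ r k n) where
  carrier := {u | (∀ i ∈ σ, u.1 i = 0) ∧
    ∀ w ∈ fiberDir r k n σ, fderiv ℝ (fderiv ℝ F) z u w = 0}
  add_mem' := by
    rintro a b ⟨ha, ha'⟩ ⟨hb, hb'⟩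
    exact ⟨fun i hi => by simp [ha i hi, hb i hi], fun w hw => by simp [ha' w hw, hb' w hw]⟩
  zero_mem' := ⟨fun _ _ => rfl, fun _ _ => by simp⟩
  smul_mem' := by
    rintro c a ⟨ha, ha'⟩
    exact ⟨fun i hi => by simp [ha i hi], fun w hw => by simp [ha' w hw]⟩

theorem eventually_linearIndependent_of_sNondegenerate (hF : ∀ᶠ z in 𝓝 0, ContDiffAt ℝ ∞ F z)
    (hN : SNondegenerate F) :
    ∀ᶠ z in 𝓝 0, LinearIndependent ℝ
      (Sum.elim (fun i : Fin r => fderiv ℝ (fun z : XYQ r k n => z.1 i) z)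
        (Sum.elim (fun i : Fin r => fderiv ℝ (dX F i) z)
          (fun j : Fin k => fderiv ℝ (dY F j) z))) := by
  have h0 := hF.self_of_nhds
  have hF' : ContDiffAt ℝ ∞ (fderiv ℝ F) 0 := h0.fderiv_right (m := ∞) (by simp)
  have hc : ∀ w, ContinuousAt (fderiv ℝ (fun z => fderiv ℝ F z w)) 0 := fun w =>
    (hF'.clm_apply contDiffAt_const).differentiableAt_fderiv.continuousAt
  have hcont : ContinuousAt (fun z : XYQ r k n =>
      Sum.elim (fun i : Fin r => fderiv ℝ (fun z : XYQ r k n => z.1 i) z)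
        (Sum.elim (fun i : Fin r => fderiv ℝ (dX F i) z)
          (fun j : Fin k => fderiv ℝ (dY F j) z)))
      0 := by
    refine continuousAt_pi.2 ?_
    rintro (i | i | j)
    · simp only [Sum.elim_inl, fderiv_coordX]
      exact continuousAt_const
    · exact hc _
    · exact hc _
  exact hcont.eventually (LinearIndependent.eventually hN)

/-- The space is cut out by `r + k` independent equations in dimension `r + k + n`. Only the upper
bound is needed, as an injection of `ℝⁿ` supplies the lower one. -/
theorem finrank_criticalTangent_le {σ : Finset (Fin r)} {z : XYQ r k n} (hF : ContDiffAt ℝ ∞ F z)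
    (h : LinearIndependent ℝ (Sum.elim (fun i : Fin r => fderiv ℝ (fun z : XYQ r k n => z.1 i) z)
        (Sum.elim (fun i : Fin r => fderiv ℝ (dX F i) z)
          (fun j : Fin k => fderiv ℝ (dY F j) z)))) :
    Module.finrank ℝ (criticalTangent F σ z) ≤ n := by
  -- For each `i` this selects `dx_i` if `i ∈ σ` and `d(∂F/∂x_i)` otherwise, together with all
  -- `d(∂F/∂y_j)`.
  let e : Fin r ⊕ Fin k → Fin r ⊕ (Fin r ⊕ Fin k) :=
    Sum.elim (fun i => if i ∈ σ then Sum.inl i else Sum.inr (Sum.inl i))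
      (fun j => Sum.inr (Sum.inr j))
  have he : Function.Injective e := by
    rintro (i | i) (j | j) hij
    · simp only [e, Sum.elim_inl] at hij
      split_ifs at hij <;> simp_all
    · simp only [e, Sum.elim_inl, Sum.elim_inr] at hij
      split_ifs at hij
      simp_all
    · simp only [e, Sum.elim_inl, Sum.elim_inr] at hij
      split_ifs at hij
      simp_all
    · simp_all [e]
  have h2 := (h.comp e he).map' (ContinuousLinearMap.coeLM ℝ)
    (LinearMap.ker_eq_bot.2 ContinuousLinearMap.coe_injective)
  have h3 := finrank_span_eq_card h2
  have h5 : criticalTangent F σ z ≤ (Submodule.span ℝ (range (ContinuousLinearMap.coeLM ℝ ∘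
      (Sum.elim (fun i : Fin r => fderiv ℝ (fun z : XYQ r k n => z.1 i) z)
        (Sum.elim (fun i : Fin r => fderiv ℝ (dX F i) z)
          (fun j : Fin k => fderiv ℝ (dY F j) z))) ∘ e))).dualCoannihilator := by
    rintro u ⟨hu, hu'⟩
    obtain ⟨hx, hy⟩ := (forall_mem_fiberDir_iff _).1 hu'
    rw [Submodule.mem_dualCoannihilator]
    intro φ hφ
    induction hφ using Submodule.span_induction with
    | mem φ hφ =>
      obtain ⟨i | j, rfl⟩ := hφ
      · by_cases hi : i ∈ σ
        · simpa [e, hi, fderiv_coordX] using hu i hi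
        · simpa [e, hi, fderiv_dX hF] using hx i hi
      · simpa [e, fderiv_dY hF] using hy j
    | zero => simp
    | add φ φ' _ _ h h' => simp [h, h']
    | smul c φ _ h => simp [h]
  have h4 := Submodule.finrank_mono h5
  have h6 := Subspace.finrank_add_finrank_dualCoannihilator_eq (K := ℝ)
    (Submodule.span ℝ (range (ContinuousLinearMap.coeLM ℝ ∘
      (Sum.elim (fun i : Fin r => fderiv ℝ (fun z : XYQ r k n => z.1 i) z)
        (Sum.elim (fun i : Fin r => fderiv ℝ (dX F i) z)
          (fun j : Fin k => fderiv ℝ (dY F j) z))) ∘ e)))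
  rw [h3] at h6
  simp only [Fintype.card_sum, Fintype.card_fin, Module.finrank_prod, Module.finrank_fin_fun] at h6
  omega

end GeneratingFamily

/-! ### The tangent space of `L_σ⁰` -/

section TangentSpace

variable {r n : ℕ}

open Classical in
/-- A parametrization of the tangent space of `L_σ⁰`. -/
noncomputable def tangentParam (hrn : r ≤ n) (σ : Finset (Fin r)) :
    (Fin n → ℝ) →ₗ[ℝ] Cotangent n where
  toFun c := (fun j => if ∃ i ∉ σ, Fin.castLE hrn i = j then c j else 0,
    fun j => if ∃ i ∉ σ, Fin.castLE hrn i = j then 0 else c j)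
  map_add' a b := by
    refine Prod.ext (funext fun j => ?_) (funext fun j => ?_) <;>
      by_cases h : ∃ i ∉ σ, Fin.castLE hrn i = j <;> simp [h]
  map_smul' c a := by
    refine Prod.ext (funext fun j => ?_) (funext fun j => ?_) <;>
      by_cases h : ∃ i ∉ σ, Fin.castLE hrn i = j <;> simp [h]

theorem tangentParam_injective (hrn : r ≤ n) (σ : Finset (Fin r)) :
    Function.Injective (tangentParam hrn σ) := by
  refine (injective_iff_map_eq_zero _).2 fun c hc => funext fun j => ?_
  have h1 := congrFun (congrArg Prod.fst hc) j
  have h2 := congrFun (congrArg Prod.snd hc) j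
  by_cases h : ∃ i ∉ σ, Fin.castLE hrn i = j
  · simpa [tangentParam, h] using h1
  · simpa [tangentParam, h] using h2

theorem tangentParam_mem (hrn : r ≤ n) (σ : Finset (Fin r)) (c : Fin n → ℝ) :
    tangentParam hrn σ c ∈ tangentL hrn σ := by
  refine ⟨fun i hi => if_neg ?_, fun i hi => if_pos ⟨i, hi, rfl⟩, fun j hj => if_neg ?_⟩
  · rintro ⟨i', hi', h⟩
    exact hi' (Fin.castLE_injective hrn h ▸ hi)
  · rintro ⟨i', hi', rfl⟩
    simp at hj
    omega

theorem exists_tangentParam_eq (hrn : r ≤ n) (σ : Finset (Fin r)) {v : Cotangent n}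
    (hv : v ∈ tangentL hrn σ) : ∃ c, tangentParam hrn σ c = v := by
  obtain ⟨h1, h2, h3⟩ := hv
  -- For each `j` one of `q_j`, `p_j` vanishes on the tangent space, so the sum is the remaining
  -- coordinate.
  refine ⟨v.1 + v.2, Prod.ext (funext fun j => ?_) (funext fun j => ?_)⟩
  · by_cases h : ∃ i ∉ σ, Fin.castLE hrn i = j
    · obtain ⟨i, hi, rfl⟩ := h
      refine (if_pos ⟨i, hi, rfl⟩).trans ?_
      simp [h2 i hi]
    · refine (if_neg h).trans ?_
      by_cases hj : r ≤ (j : ℕ)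
      · exact (h3 j hj).symm
      · have hi : Fin.castLE hrn ⟨j, by omega⟩ = j := rfl
        by_cases hσ : (⟨j, by omega⟩ : Fin r) ∈ σ
        · exact (h1 _ hσ).symm
        · exact absurd ⟨_, hσ, hi⟩ h
  · by_cases h : ∃ i ∉ σ, Fin.castLE hrn i = j
    · obtain ⟨i, hi, rfl⟩ := h
      exact (if_pos ⟨i, hi, rfl⟩).trans (h2 i hi).symm
    · refine (if_neg h).trans ?_
      have : v.1 j = 0 := by
        by_cases hj : r ≤ (j : ℕ)
        · exact h3 j hj
        · have hi : Fin.castLE hrn ⟨j, by omega⟩ = j := rfl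
          by_cases hσ : (⟨j, by omega⟩ : Fin r) ∈ σ
          · exact h1 _ hσ
          · exact absurd ⟨_, hσ, hi⟩ h
      simp [this]

/-- The basis vectors of the tangent space are covered, so it is spanned by directions of half-lines
inside `L_σ⁰`, even at boundary points. -/
theorem add_smul_tangentParam_mem_stdL {hrn : r ≤ n} {σ : Finset (Fin r)} {z : Cotangent n}
    (hz : z ∈ stdL hrn σ) {c : Fin n → ℝ} (hc : 0 ≤ c) {t : ℝ} (ht : 0 ≤ t) :
    z + t • tangentParam hrn σ c ∈ stdL hrn σ := by
  obtain ⟨⟨h1, h2, h3⟩, h4⟩ := hz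
  obtain ⟨k1, k2, k3⟩ := tangentParam_mem hrn σ c
  refine ⟨⟨fun i hi => by simp [h1 i hi, k1 i hi], fun i hi => by simp [h2 i hi, k2 i hi],
    fun j hj => by simp [h3 j hj, k3 j hj]⟩, fun i hi => add_nonneg (h4 i hi) (mul_nonneg ht ?_)⟩
  exact (hc (Fin.castLE hrn i)).trans_eq (if_pos ⟨i, hi, rfl⟩).symm

end TangentSpace

/-! ### Critical points of `π ∘ i` as degenerate critical points of `F` -/

section Correspondence

variable {r k n : ℕ} {hrn : r ≤ n} {S : SymplecticGerm n} {F : XYQ r k n → ℝ}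

/-- Differentiating along `L_σ⁰` shows that `dA` maps its tangent space into `criticalTangent` and
that `d(toCotangent F) ∘ dA = dS` there. As `dS` is injective, so is `dA`, and the dimension bound
makes it an isomorphism onto `criticalTangent`. The `q`-component of `dS(v)` is that of `dA(v)`, so
the kernel of `d(π ∘ S)` corresponds to the vectors of `criticalTangent` with zero `q`-component,
which are the null vectors of the fiber Hessian. -/
theorem mem_singularPoints_iff {A : Cotangent n → XYQ r k n} {σ : Finset (Fin r)} {z : Cotangent n}
    (hz : z ∈ stdL hrn σ) (hzs : z ∈ S.toHomeo.source) (hA : DifferentiableAt ℝ A z)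
    (hloc : ∀ᶠ z' in 𝓝 z, z' ∈ stdL hrn σ →
      A z' ∈ fiberCritical F σ ∧ toCotangent F (A z') = S.toHomeo z')
    (hF : ContDiffAt ℝ ∞ F (A z))
    (hdim : Module.finrank ℝ (criticalTangent F σ (A z)) ≤ n) :
    z ∈ singularPoints hrn S σ ↔ A z ∈ degeneratePoints F σ := by
  have hline : ∀ j : Fin n, ∀ᶠ t in 𝓝[≥] (0 : ℝ),
      A (z + t • tangentParam hrn σ (Pi.single j 1)) ∈ fiberCritical F σ ∧
        toCotangent F (A (z + t • tangentParam hrn σ (Pi.single j 1))) =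
          S.toHomeo (z + t • tangentParam hrn σ (Pi.single j 1)) := by
    intro j
    have hc : ContinuousAt (fun t : ℝ => z + t • tangentParam hrn σ (Pi.single j 1)) 0 := by
      fun_prop
    have hev : ∀ᶠ t in 𝓝[≥] (0 : ℝ), _ :=
      (hc.eventually (by simpa using hloc)).filter_mono nhdsWithin_le_nhds
    filter_upwards [hev, self_mem_nhdsWithin] with t h1 h2
    exact h1 (add_smul_tangentParam_mem_stdL hz (Pi.single_nonneg.2 zero_le_one) h2)
  have hz0 := hloc.self_of_nhds hz
  have hcr := mem_fiberCritical_iff.1 hz0.1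
  let L := fderiv ℝ A z
  have hLT : ∀ c, L (tangentParam hrn σ c) ∈ criticalTangent F σ (A z) := by
    have hsingle : ∀ j : Fin n,
        L (tangentParam hrn σ (Pi.single j 1)) ∈ criticalTangent F σ (A z) := by
      refine fun j => ⟨fun i hi => ?_, fun w hw => ?_⟩
      · have h1 := ((ContinuousLinearMap.proj (R := ℝ) (φ := fun _ : Fin r => ℝ) i).comp
          (ContinuousLinearMap.fst ℝ (Fin r → ℝ)
            ((Fin k → ℝ) × (Fin n → ℝ)))).hasFDerivAt.comp z hA.hasFDerivAt
        have h2 := fderiv_apply_eq_zero_of_eventually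
          (w := tangentParam hrn σ (Pi.single j 1)) h1.differentiableAt (by
            filter_upwards [hline j] with t ht
            exact ((mem_fiberCritical_iff.1 ht.1).2.1 i hi).trans (hcr.2.1 i hi).symm)
        rw [h1.fderiv] at h2
        exact h2
      · have h1 := (hasFDerivAt_fderiv_apply hF w).comp z hA.hasFDerivAt
        have h2 := fderiv_apply_eq_zero_of_eventually
          (w := tangentParam hrn σ (Pi.single j 1)) h1.differentiableAt (by
            filter_upwards [hline j] with t ht
            exact ((mem_fiberCritical_iff.1 ht.1).2.2 w hw).trans (hcr.2.2 w hw).symm)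
        rw [h1.fderiv] at h2
        exact h2
    intro c
    rw [pi_eq_sum_univ' c]
    simp only [map_sum, map_smul]
    exact Submodule.sum_mem _ fun j _ => Submodule.smul_mem _ _ (hsingle j)
  have hLS : ∀ c, fderiv ℝ (toCotangent F) (A z) (L (tangentParam hrn σ c)) =
      fderiv ℝ S.toHomeo z (tangentParam hrn σ c) := by
    have hsingle : ∀ j : Fin n,
        fderiv ℝ (toCotangent F) (A z) (L (tangentParam hrn σ (Pi.single j 1))) =
          fderiv ℝ S.toHomeo z (tangentParam hrn σ (Pi.single j 1)) := by
      intro j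
      have h1 := (((contDiffAt_toCotangent hF).differentiableAt (by simp)).hasFDerivAt.comp z
        hA.hasFDerivAt).sub (S.differentiableAt hzs).hasFDerivAt
      have h2 := fderiv_apply_eq_zero_of_eventually
        (w := tangentParam hrn σ (Pi.single j 1)) h1.differentiableAt (by
          filter_upwards [hline j] with t ht
          simp [ht.2, hz0.2])
      rw [h1.fderiv] at h2
      exact sub_eq_zero.1 h2
    intro c
    rw [pi_eq_sum_univ' c]
    simp only [map_sum, map_smul, hsingle]
  have hL0 : ∀ c, L (tangentParam hrn σ c) = 0 → c = 0 := by
    intro c hc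
    have h1 := hLS c
    rw [hc, map_zero] at h1
    have h2 := S.fderiv_injective hzs (h1.symm.trans (map_zero _).symm)
    exact tangentParam_injective hrn σ (h2.trans (map_zero _).symm)
  constructor
  · rintro ⟨v, hv, hv0, hv1⟩
    obtain ⟨c, rfl⟩ := exists_tangentParam_eq hrn σ hv
    obtain ⟨h1, h2⟩ := hLT c
    refine ⟨L (tangentParam hrn σ c), ⟨?_, h1⟩, fun h0 => hv0 ?_, h2⟩
    · rw [← fderiv_toCotangent_fst hF, hLS, hv1]
    · rw [hL0 c h0, map_zero]
  · rintro ⟨u, hu, hu0, hdeg⟩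
    let M : (Fin n → ℝ) →ₗ[ℝ] criticalTangent F σ (A z) :=
      ((L : Cotangent n →ₗ[ℝ] XYQ r k n) ∘ₗ tangentParam hrn σ).codRestrict _ hLT
    have hM : Function.Injective M :=
      (injective_iff_map_eq_zero _).2 fun c hc => hL0 c (congrArg Subtype.val hc)
    have hrank : Module.finrank ℝ (Fin n → ℝ) = Module.finrank ℝ (criticalTangent F σ (A z)) :=
      le_antisymm (LinearMap.finrank_le_finrank_of_injective hM) (by simpa using hdim)
    obtain ⟨c, hc⟩ := (LinearMap.injective_iff_surjective_of_finrank_eq_finrank hrank).1 hM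
      ⟨u, hu.2, hdeg⟩
    have hc' : L (tangentParam hrn σ c) = u := congrArg Subtype.val hc
    refine ⟨tangentParam hrn σ c, tangentParam_mem hrn σ c, fun h0 => hu0 ?_, ?_⟩
    · rw [← hc', h0, map_zero]
    · rw [← hLS, hc', fderiv_toCotangent_fst hF, hu.1]

/-- A generating family parametrizes the `L_σ⁰` by its fiberwise critical points, and the
critical points of the projections correspond to the degenerate ones. -/
theorem IsGeneratingFamily.exists_isGermIso (h : IsGeneratingFamily hrn S F) :
    ∃ A B, IsGermIso A B (stdL hrn) (singularPoints hrn S) (fun z => (S.toHomeo z).1)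
      (fiberCritical F) (degeneratePoints F) (fun z => z.2.2) id := by
  obtain ⟨hsm, -, hF0, hN, U, hU, hgen⟩ := h
  have hF := hsm.eventually_contDiffAt
  obtain ⟨ρ, hρ, hρ0, hρF⟩ := exists_leftInverse_toCotangent hF.self_of_nhds hF0 hN
  -- The definition of a generating family only equates images. Using it on a neighbourhood where
  -- `ρ` recovers critical points identifies the preimage of `S z` as `ρ (S z)`, the same formula
  -- for every `σ`.
  have hW : {z | (∀ j, dY F j z = 0) → ρ (toCotangent F z) = z} ∩ U ∈ 𝓝 0 := inter_mem hρF hU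
  have hset : ∀ᶠ c in 𝓝 0, ∀ σ, c ∈ S.toHomeo '' (stdL hrn σ ∩ S.toHomeo.source) ↔
      c ∈ toCotangent F ''
        (fiberCritical F σ ∩ ({z | (∀ j, dY F j z = 0) → ρ (toCotangent F z) = z} ∩ U)) := by
    rw [eventually_all]
    exact fun σ => (hgen _ hW inter_subset_right σ).mem_iff
  have hj : Tendsto (toCotangent F) (𝓝 0) (𝓝 0) := by
    simpa [ContinuousAt, toCotangent_zero hF0] using
      (contDiffAt_toCotangent hF.self_of_nhds).continuousAt
  have hρt : Tendsto ρ (𝓝 0) (𝓝 0) := by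
    simpa [ContinuousAt, hρ0] using hρ.continuousAt
  have hA : Tendsto (ρ ∘ S.toHomeo) (𝓝 0) (𝓝 0) := hρt.comp S.tendsto
  have hfwd : ∀ᶠ z in 𝓝 0, ∀ σ, z ∈ stdL hrn σ → ρ (S.toHomeo z) ∈ fiberCritical F σ ∧
      toCotangent F (ρ (S.toHomeo z)) = S.toHomeo z := by
    filter_upwards [S.tendsto.eventually hset, S.source_mem] with z hz hs σ hσ
    obtain ⟨ζ, ⟨hζ, hζρ, -⟩, hζz⟩ := (hz σ).1 ⟨z, ⟨hσ, hs⟩, rfl⟩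
    have h1 := hζρ hζ.2.2.2
    rw [hζz] at h1
    rw [h1]
    exact ⟨hζ, hζz⟩
  refine ⟨ρ ∘ S.toHomeo, S.toHomeo.symm ∘ toCotangent F, hA, S.tendsto_symm.comp hj, ?_, ?_⟩
  · have hρd : ∀ᶠ c in 𝓝 0, DifferentiableAt ℝ ρ c := by
      -- Finite-order smoothness at a point spreads to a neighbourhood, which order `∞` need not do;
      -- order one suffices.
      filter_upwards [(hρ.of_le (m := 1) (by simp)).eventually (by simp)] with c hc
      exact hc.differentiableAt one_ne_zero
    filter_upwards [hfwd, hfwd.eventually_nhds, S.source_mem, S.tendsto.eventually hρd,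
      hA.eventually hF, hA.eventually (eventually_linearIndependent_of_sNondegenerate hF hN)]
      with z h1 h2 h3 h4 h5 h6 σ hσ
    obtain ⟨k1, k2⟩ := h1 σ hσ
    refine ⟨k1, ?_, congrArg Prod.fst k2, ?_⟩
    · simp [k2, S.toHomeo.left_inv h3]
    · refine mem_singularPoints_iff hσ h3 (h4.comp z (S.differentiableAt h3)) ?_ h5
        (finrank_criticalTangent_le h5 h6)
      filter_upwards [h2] with z' hz' using hz' σ
  · filter_upwards [hj.eventually hset, hW] with ζ hζ hζW σ hσ
    obtain ⟨z, ⟨hz, hzs⟩, hzζ⟩ := (hζ σ).2 ⟨ζ, ⟨hσ, hζW⟩, rfl⟩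
    have h1 : S.toHomeo.symm (toCotangent F ζ) = z := by
      rw [← hzζ, S.toHomeo.left_inv hzs]
    refine ⟨by simpa [h1] using hz, ?_⟩
    simp only [Function.comp_apply, h1, hzζ]
    exact hζW.1 hσ.2.2.2

end Correspondence

/-! ### Conclusion -/

theorem proposition2p4 {r n k₁ k₂ : ℕ} (hrn : r ≤ n) (S₁ S₂ : SymplecticGerm n)
    (F₁ : XYQ r k₁ n → ℝ) (F₂ : XYQ r k₂ n → ℝ)
    (h₁ : IsGeneratingFamily hrn S₁ F₁) (h₂ : IsGeneratingFamily hrn S₂ F₂)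
    (h : StablyPCEquivalent F₁ F₂) :
    CausticEquivalent hrn S₁ S₂ := by
  obtain ⟨l, l', Q, Q', hQ, hQ', Φ, a, b, hΦ, ha, ha0, hb, heq⟩ := h
  obtain ⟨ψ, hψ⟩ := hΦ.2.2
  obtain ⟨g, hg⟩ := exists_diffeoGerm_of_fibered hψ
  have hF₁ := h₁.1.eventually_contDiffAt
  have hF₂ := h₂.1.eventually_contDiffAt
  obtain ⟨A₁, B₁, H₁⟩ := h₁.exists_isGermIso
  obtain ⟨A₂, B₂, H₂⟩ := h₂.exists_isGermIso
  -- As `F₂` is expressed by pulling back `F₁`, the chain runs from the `L_σ⁰` of `S₂` to those of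
  -- `S₁` over `ψ`; only the part over the identity is reversed.
  have H := (H₂.trans (isGermIso_addQuadratic hF₂ hQ')).trans
    ((isGermIso_of_eq_mul_comp_add hΦ hψ ha.eventually_contDiffAt ha0 hb.eventually_contDiffAt
      (eventually_contDiffAt_addQuadratic hF₁ Q) (eventually_contDiffAt_addQuadratic hF₂ Q')
      heq).trans (H₁.trans (isGermIso_addQuadratic hF₁ hQ)).symm)
  exact CausticEquivalent.of_isGermIso H g hg
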